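/- Let $X$ be a complex manifold and put $$A=T^{1,0}X\oplus (T^{0,1}X)^*,\qquad A^*=T^{0,1}X\oplus (T^{1,0}X)^*,$$ where $(T^{0,1}X)^*$ and $(T^{1,0}X)^*$ are the complex covectors vanishing on $T^{1,0}X$ and $T^{0,1}X$ respectively, and $\langle X+\xi,V+\eta\rangle=\eta(X)+\xi(V)$ is the duality pairing. Both are complex Lie algebroids: the anchors $a$, $a_*$ are the projections to $T_{\mathbb C}X$, and the brackets are $$[X+\xi,Y+\zeta]=[X,Y]+L_X\zeta-L_Y\xi,\qquad [V+\eta,W+\zeta]_*=[V,W]+L_V\zeta-L_W\eta$$ on smooth sections of $A$ and of $A^*$. Let $H$ be an extended Poisson structure on $X$, that is, a smooth section of $\wedge^2A$ with $$\bar\partial H+\tfrac12[H,H]=0,$$ where $\bar\partial$ is the Lie algebroid differential of $A^*$ and $[\cdot,\cdot]$ is the Schouten (Gerstenhaber) bracket on sections of $\wedge^\bullet A$. Let $H^\sharp:A^*\to A$ be the contraction, $\langle H^\sharp\alpha,\beta\rangle=H(\alpha,\beta)$. The $H$-twisted Lie algebroid $A^*_H$ is the bundle $A^*$ with anchor $a_*^H=a_*+a\circ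 H^\sharp$ and bracket $$[\alpha,\beta]_*^H=[\alpha,\beta]_*+L_{H^\sharp\alpha}\beta-L_{H^\sharp\beta}\alpha-d\langle H^\sharp\alpha,\beta\rangle,$$ where, for smooth sections $u,v$ of $A$ and $\beta$ of $A^*$ and a smooth function $f$, $\langle L_u\beta,v\rangle=a(u)\langle\beta,v\rangle-\langle\beta,[u,v]\rangle$ and $\langle df,v\rangle=a(v)f$. Let $Y\subseteq X$ be an embedded complex submanifold, let $N^{1,0}Y\subseteq (T^{1,0}X)^*|_Y$ be the annihilator of $T^{1,0}Y$, and put $K=T^{0,1}Y\oplus N^{1,0}Y\subseteq A^*|_Y$. Suppose that $Y$ is coisotropic, that is, $H(u,v)=0$ for all $u,v\in K$ over the same point of $Y$. Then $K$ is a Lie subalgebroid of $A^*_H$, in the following sense. 1. The anchor $a_*^H$ maps $K$ into $T_{\mathbb C}Y$. 2. For any two smooth sections $u,v$ of $K$ over $Y$ there is a smooth section $w$ of $K$ over $Y$ such that, for all smooth sections $\tilde u,\tilde v$ of $A^*_H$ over $X$ that extend $u$ and $v$, the restriction of $[\tilde u,\tilde v]_*^H$ to $Y$ is $w$. In other words,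 this restriction is a smooth section of $K$ which does not depend on the choice of the extensions. -/

import Mathlib

open scoped Manifold ContDiff TensorProduct
open Bundle

noncomputable section

namespace ExtendedPoisson

/-! ### Linear algebra -/

section LinearAlgebra

variable {V : Type*} [AddCommGroup V] [Module ℝ V]

/-- Real part `ℂ ⊗ V → V` of a complexified vector. -/
def rePart : ℂ ⊗[ℝ] V →ₗ[ℝ] V :=
  (TensorProduct.lid ℝ V).toLinearMap ∘ₗ LinearMap.rTensor V Complex.reLm

/-- Imaginary part `ℂ ⊗ V → V` of a complexified vector. -/
def imPart : ℂ ⊗[ℝ] V →ₗ[ℝ] V :=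
  (TensorProduct.lid ℝ V).toLinearMap ∘ₗ LinearMap.rTensor V Complex.imLm

/-- The complexified vector `v + i w`. -/
def ofReIm (v w : V) : ℂ ⊗[ℝ] V := (1 : ℂ) ⊗ₜ[ℝ] v + Complex.I ⊗ₜ[ℝ] w

variable {A B : Type*} [AddCommGroup A] [Module ℂ A] [AddCommGroup B] [Module ℂ B]

/-- For a pairing `p : A × B → ℂ`, the alternating map
`(u, v) ↦ (β ↦ p(u, β) v - p(v, β) u)`. -/
def contractionAlt (p : A →ₗ[ℂ] B →ₗ[ℂ] ℂ) : A [⋀^Fin 2]→ₗ[ℂ] (B →ₗ[ℂ] A) where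
  toFun m := (p (m 0)).smulRight (m 1) - (p (m 1)).smulRight (m 0)
  map_update_add' := by
    intro _ m i x y
    fin_cases i <;> ext b <;> simp [add_smul, smul_add] <;> abel
  map_update_smul' := by
    intro _ m i c x
    fin_cases i <;> ext b <;> simp [smul_sub, smul_smul, mul_comm]
  map_eq_zero_of_eq' := by
    intro m i j h hij
    have h01 : m 0 = m 1 := by
      fin_cases i <;> fin_cases j <;> simp_all
    simp [h01]

/-- Contraction of a bivector: `(u ∧ v)♯ β = p(u, β) v - p(v, β) u`. -/
def contraction (p : A →ₗ[ℂ] B →ₗ[ℂ] ℂ) : (⋀[ℂ]^2 A) →ₗ[ℂ] (B →ₗ[ℂ] A) :=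
  exteriorPower.alternatingMapLinearEquiv (contractionAlt p)

end LinearAlgebra

/-! ### Complex manifolds as real smooth manifolds -/

/-- A complex manifold is a real analytic (in particular smooth) manifold. -/
instance realManifold {E : Type*} [NormedAddCommGroup E] [NormedSpace ℂ E]
    {X : Type*} [TopologicalSpace X] [ChartedSpace E X] [h : IsManifold 𝓘(ℂ, E) ω X] :
    IsManifold 𝓘(ℝ, E) ω X := by
  apply isManifold_of_contDiffOn
  intro e e' he he'
  have h1 := (contDiffGroupoid ω 𝓘(ℂ, E)).compatible he he'
  rw [contDiffGroupoid, mem_groupoid_of_pregroupoid] at h1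
  exact ContDiffOn.restrict_scalars ℝ h1.1

section Manifold

variable (E : Type*) [NormedAddCommGroup E] [NormedSpace ℂ E]
  {X : Type*} [TopologicalSpace X] [ChartedSpace E X]

/-! ### Complexified tangent and cotangent spaces, types -/

/-- The complexified tangent space `T_ℂ,x X = ℂ ⊗ T_x X`. -/
abbrev TC (x : X) := ℂ ⊗[ℝ] TangentSpace 𝓘(ℝ, E) x

/-- The complexified cotangent space `T*_ℂ,x X`: real-linear maps `T_x X → ℂ`. -/
abbrev CotC (x : X) := TangentSpace 𝓘(ℝ, E) x →ₗ[ℝ] ℂ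

/-- The almost complex structure `J` on `T_x X`. -/
def J (x : X) : TangentSpace 𝓘(ℝ, E) x →ₗ[ℝ] TangentSpace 𝓘(ℝ, E) x :=
  (Complex.I • LinearMap.id : E →ₗ[ℝ] E)

/-- The `ℂ`-linear extension of `J` to `T_ℂ,x X`. -/
def JC (x : X) : TC E x →ₗ[ℂ] TC E x := (J E x).baseChange ℂ

/-- The holomorphic tangent space `T^{1,0}`, the `+i`-eigenspace of `J`. -/
def T10 (x : X) : Submodule ℂ (TC E x) := Module.End.eigenspace (JC E x) Complex.I

/-- The antiholomorphic tangent space `T^{0,1}`, the `-i`-eigenspace of `J`. -/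
def T01 (x : X) : Submodule ℂ (TC E x) := Module.End.eigenspace (JC E x) (-Complex.I)

/-- The `ℂ`-bilinear evaluation of complex covectors on complex tangent vectors. -/
def evalC (x : X) : CotC E x →ₗ[ℂ] TC E x →ₗ[ℂ] ℂ :=
  (LinearMap.liftBaseChangeEquiv ℂ).toLinearMap

/-- `(T^{1,0})*`, as the covectors vanishing on `T^{0,1}`. -/
def Cot10 (x : X) : Submodule ℂ (CotC E x) where
  carrier := {η | ∀ v ∈ T01 E x, evalC E x η v = 0}
  add_mem' := by intro a b ha hb v hv; simp [ha v hv, hb v hv]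
  zero_mem' := by intro v _; simp
  smul_mem' := by intro c a ha v hv; simp [ha v hv]

/-- `(T^{0,1})*`, as the covectors vanishing on `T^{1,0}`. -/
def Cot01 (x : X) : Submodule ℂ (CotC E x) where
  carrier := {η | ∀ v ∈ T10 E x, evalC E x η v = 0}
  add_mem' := by intro a b ha hb v hv; simp [ha v hv, hb v hv]
  zero_mem' := by intro v _; simp
  smul_mem' := by intro c a ha v hv; simp [ha v hv]

/-- The fibre of `A = T^{1,0} ⊕ (T^{0,1})*`. -/
def A (x : X) : Submodule ℂ (TC E x × CotC E x) := (T10 E x).prod (Cot01 E x)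

/-- The fibre of the dual bundle `A* = T^{0,1} ⊕ (T^{1,0})*`. -/
def Astar (x : X) : Submodule ℂ (TC E x × CotC E x) := (T01 E x).prod (Cot10 E x)

/-- The duality pairing `⟨X + ξ, V + η⟩ = η(X) + ξ(V)` of `A` with `A*`. -/
def pairing (x : X) : A E x →ₗ[ℂ] Astar E x →ₗ[ℂ] ℂ :=
  LinearMap.mk₂ ℂ (fun u α ↦ evalC E x α.1.2 u.1.1 + evalC E x u.1.2 α.1.1)
    (by intros; simp; ring) (by intros; simp; ring)
    (by intros; simp; ring) (by intros; simp; ring)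

/-! ### Projections onto types -/

variable {E}

lemma J_J (x : X) (v : TangentSpace 𝓘(ℝ, E) x) : J E x (J E x v) = -v := by
  have h (w : E) : Complex.I • (Complex.I • w) = -w := by
    rw [smul_smul, Complex.I_mul_I, neg_one_smul]
  exact h v

lemma JC_JC (x : X) (v : TC E x) : JC E x (JC E x v) = -v := by
  induction v using TensorProduct.induction_on with
  | zero => simp
  | tmul z v => simp [JC, J_J, TensorProduct.tmul_neg]
  | add a b ha hb => simp [ha, hb, add_comm]

lemma evalC_comp_J (x : X) (η : CotC E x) (v : TC E x) :
    evalC E x (η ∘ₗ J E x) v = evalC E x η (JC E x v) := by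
  induction v using TensorProduct.induction_on with
  | zero => simp
  | tmul z v => simp [JC, evalC]
  | add a b ha hb => simp only [map_add, ha, hb]

/-- The projection of `T_ℂ ⊕ T*_ℂ` onto `A` along `A*`. -/
def projA (x : X) (τ : TC E x × CotC E x) : A E x :=
  ⟨((1 / 2 : ℂ) • (τ.1 - Complex.I • JC E x τ.1),
    (1 / 2 : ℂ) • (τ.2 + Complex.I • (τ.2 ∘ₗ J E x))), by
    refine ⟨?_, fun v hv ↦ ?_⟩
    · refine Module.End.mem_eigenspace_iff.2 ?_
      simp only [map_smul, map_sub, JC_JC]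
      rw [smul_comm, smul_sub Complex.I, smul_smul Complex.I Complex.I, Complex.I_mul_I]
      congr 1
      module
    · have h := Module.End.mem_eigenspace_iff.1 hv
      simp only [map_smul, map_add, LinearMap.smul_apply, LinearMap.add_apply, evalC_comp_J, h,
        smul_eq_mul]
      linear_combination (1 / 2 * evalC E x τ.2 v) * Complex.I_mul_I⟩

/-- The projection of `T_ℂ ⊕ T*_ℂ` onto `A*` along `A`. -/
def projAstar (x : X) (τ : TC E x × CotC E x) : Astar E x :=
  ⟨((1 / 2 : ℂ) • (τ.1 + Complex.I • JC E x τ.1),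
    (1 / 2 : ℂ) • (τ.2 - Complex.I • (τ.2 ∘ₗ J E x))), by
    refine ⟨?_, fun v hv ↦ ?_⟩
    · refine Module.End.mem_eigenspace_iff.2 ?_
      simp only [map_smul, map_add, JC_JC]
      rw [smul_comm, smul_add (-Complex.I), smul_smul (-Complex.I) Complex.I, neg_mul,
        Complex.I_mul_I]
      congr 1
      module
    · have h := Module.End.mem_eigenspace_iff.1 hv
      simp only [map_smul, map_sub, LinearMap.smul_apply, LinearMap.sub_apply, evalC_comp_J, h,
        smul_eq_mul]
      linear_combination (1 / 2 * evalC E x τ.2 v) * Complex.I_mul_I⟩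

/-! ### Calculus with complex vector fields and complex one-forms -/

/-- The differential `df` of a complex function, a complex one-form. -/
def dC (f : X → ℂ) (x : X) : CotC E x := (mvfderiv 𝓘(ℝ, E) f x).toLinearMap

/-- The derivative `V f` of a complex function along a complex vector field. -/
def derivAlong (V : Π x : X, TC E x) (f : X → ℂ) (x : X) : ℂ :=
  evalC E x (dC f x) (V x)

/-- The Lie bracket of complex vector fields: the `ℂ`-bilinear extension of the Lie bracket of
real vector fields. -/
def lieBracketC (V W : Π x : X, TC E x) (x : X) : TC E x :=
  let L := VectorField.mlieBracket 𝓘(ℝ, E)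
  ofReIm
    (L (fun y ↦ rePart (V y)) (fun y ↦ rePart (W y)) x
      - L (fun y ↦ imPart (V y)) (fun y ↦ imPart (W y)) x)
    (L (fun y ↦ rePart (V y)) (fun y ↦ imPart (W y)) x
      + L (fun y ↦ imPart (V y)) (fun y ↦ rePart (W y)) x)

/-- The identification of `T_x X` with the model space given by the preferred chart at `x`. -/
def tangentId (x : X) : TangentSpace 𝓘(ℝ, E) x ≃L[ℝ] E := ContinuousLinearEquiv.refl ℝ E

variable [FiniteDimensional ℂ E]

/-- A complex covector as a continuous linear map (the tangent spaces are finite dimensional). -/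
def toCLM (x : X) (η : CotC E x) : TangentSpace 𝓘(ℝ, E) x →L[ℝ] ℂ :=
  { toLinearMap := η
    cont := by
      have h (φ : E →ₗ[ℝ] ℂ) : Continuous φ := φ.continuous_of_finiteDimensional
      exact h η }

variable [IsManifold 𝓘(ℂ, E) ω X]

/-- The Lie derivative at `x` of a complex one-form along a real vector field, computed in the
preferred chart at `x` by the coordinate formula `(L_W η)(z) = (∂_W η)(z) + η(∂_z W)`. -/
def lieDerivReal (W : Π x : X, TangentSpace 𝓘(ℝ, E) x) (η : Π x : X, CotC E x) (x : X) :
    CotC E x :=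
  let ηhat : X → (E →L[ℝ] ℂ) := fun y ↦
    toCLM y (η y) ∘L (tangentId y).symm.toContinuousLinearMap ∘L tangentCoordChange 𝓘(ℝ, E) x y y
  let What : X → E := fun y ↦ tangentCoordChange 𝓘(ℝ, E) y x y (tangentId y (W y))
  (mvfderiv 𝓘(ℝ, E) ηhat x (W x)).toLinearMap ∘ₗ (tangentId x).toLinearMap
    + η x ∘ₗ (tangentId x).symm.toLinearMap ∘ₗ (mvfderiv 𝓘(ℝ, E) What x).toLinearMap

/-- The Lie derivative of a complex one-form along a complex vector field. -/
def lieDerivC (V : Π x : X, TC E x) (η : Π x : X, CotC E x) (x : X) : CotC E x :=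
  lieDerivReal (fun y ↦ rePart (V y)) η x + Complex.I • lieDerivReal (fun y ↦ imPart (V y)) η x

/-! ### Smooth sections -/

section Smooth

variable {F : Type*} [NormedAddCommGroup F] [NormedSpace ℂ F]
  {Y : Type*} [TopologicalSpace Y] [ChartedSpace F Y]

variable (F) in
/-- Smoothness of a section of `T_ℂ X ⊕ T*_ℂ X` along a map `f : Y → X`, that is, of a section of
the pulled back bundle: the real and the imaginary part of the vector component, and the covector
component, are smooth maps from `Y` to the total spaces of the bundles involved. -/
structure SmoothAlong (f : Y → X) (τ : Π y : Y, TC E (f y) × CotC E (f y)) : Prop where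
  re : ContMDiff 𝓘(ℝ, F) 𝓘(ℝ, E).tangent ∞
    (fun y ↦ (⟨f y, rePart (τ y).1⟩ : TangentBundle 𝓘(ℝ, E) X))
  im : ContMDiff 𝓘(ℝ, F) 𝓘(ℝ, E).tangent ∞
    (fun y ↦ (⟨f y, imPart (τ y).1⟩ : TangentBundle 𝓘(ℝ, E) X))
  form : ContMDiff 𝓘(ℝ, F) (𝓘(ℝ, E).prod 𝓘(ℝ, E →L[ℝ] ℂ)) ∞
    (fun y ↦ TotalSpace.mk' (E →L[ℝ] ℂ)
      (E := fun x : X ↦ TangentSpace 𝓘(ℝ, E) x →L[ℝ] Trivial X ℂ x) (f y)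
      (toCLM (f y) (τ y).2))

end Smooth

/-- A smooth section of `A` over `X`. -/
def IsSectionA (u : Π x : X, A E x) : Prop := SmoothAlong E id (fun x ↦ (u x).1)

/-- A smooth section of `A*` over `X`. -/
def IsSectionAstar (α : Π x : X, Astar E x) : Prop := SmoothAlong E id (fun x ↦ (α x).1)

/-! ### The Lie algebroids `A` and `A*` -/

/-- The bracket of sections of `A`,
`[X + ξ, Y + ζ] = [X, Y] + L_X ζ - L_Y ξ`. For smooth sections the right hand side already lies
in `A`, so that the projection changes nothing. -/
def bracketA (u v : Π x : X, A E x) (x : X) : A E x :=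
  projA x
    (lieBracketC (fun y ↦ (u y).1.1) (fun y ↦ (v y).1.1) x,
      lieDerivC (fun y ↦ (u y).1.1) (fun y ↦ (v y).1.2) x
        - lieDerivC (fun y ↦ (v y).1.1) (fun y ↦ (u y).1.2) x)

/-- The bracket of sections of `A*`,
`[V + η, W + ζ]_* = [V, W] + L_V ζ - L_W η`. For smooth sections the right hand side already lies
in `A*`, so that the projection changes nothing. -/
def bracketAstar (α β : Π x : X, Astar E x) (x : X) : Astar E x :=
  projAstar x
    (lieBracketC (fun y ↦ (α y).1.1) (fun y ↦ (β y).1.1) x,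
      lieDerivC (fun y ↦ (α y).1.1) (fun y ↦ (β y).1.2) x
        - lieDerivC (fun y ↦ (β y).1.1) (fun y ↦ (α y).1.2) x)

/-- The Lie derivative `L_u β` of a section of `A*` along a section of `A`, characterised by
`⟨L_u β, v⟩ = a(u)⟨β, v⟩ - ⟨β, [u, v]⟩` for all sections `v` of `A`. For `u = X + ξ` and
`β = V + η` it is the `A*`-component of `[X, V] + L_X η - ι_V dξ`, where
`ι_V dξ = L_V ξ - d(ξ(V))`. -/
def lieDerivAstar (u : Π x : X, A E x) (β : Π x : X, Astar E x) (x : X) : Astar E x :=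
  projAstar x
    (lieBracketC (fun y ↦ (u y).1.1) (fun y ↦ (β y).1.1) x,
      lieDerivC (fun y ↦ (u y).1.1) (fun y ↦ (β y).1.2) x
        - (lieDerivC (fun y ↦ (β y).1.1) (fun y ↦ (u y).1.2) x
          - dC (fun y ↦ evalC E y (u y).1.2 (β y).1.1) x))

/-- The Lie algebroid differential `d f = ∂ f` of a function, the section of `A*` with
`⟨d f, v⟩ = a(v) f`. -/
def dFun (f : X → ℂ) (x : X) : Astar E x := projAstar x (0, dC f x)

/-! ### Extended Poisson structures -/

/-- The contraction `H♯ : A* → A` of a bivector `H ∈ ∧² A`, with `⟨H♯ α, β⟩ = H(α, β)`. -/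
def sharp (x : X) (H : ⋀[ℂ]^2 (A E x)) : Astar E x →ₗ[ℂ] A E x :=
  contraction (A := A E x) (B := Astar E x) (pairing E x) H

/-- The value `H(α, β)` of a bivector, `(u ∧ v)(α, β) = ⟨u, α⟩⟨v, β⟩ - ⟨v, α⟩⟨u, β⟩`. -/
def bivEval (x : X) (H : ⋀[ℂ]^2 (A E x)) (α β : Astar E x) : ℂ := pairing E x (sharp x H α) β

/-- The differential `d_* = ∂̄` of the Lie algebroid `A*` on sections of `∧² A`, given by the
Cartan formula. -/
def dbar (H : Π x : X, ⋀[ℂ]^2 (A E x)) (α β γ : Π x : X, Astar E x) (x : X) : ℂ :=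
  derivAlong (fun y ↦ (α y).1.1) (fun y ↦ bivEval y (H y) (β y) (γ y)) x
    - derivAlong (fun y ↦ (β y).1.1) (fun y ↦ bivEval y (H y) (α y) (γ y)) x
    + derivAlong (fun y ↦ (γ y).1.1) (fun y ↦ bivEval y (H y) (α y) (β y)) x
    - bivEval x (H x) (bracketAstar α β x) (γ x)
    + bivEval x (H x) (bracketAstar α γ x) (β x)
    - bivEval x (H x) (bracketAstar β γ x) (α x)

/-- One of the cyclic summands of the Schouten bracket. -/
def schoutenTerm (P Q : Π x : X, ⋀[ℂ]^2 (A E x)) (α β γ : Π x : X, Astar E x) (x : X) : ℂ :=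
  pairing E x
      (bracketA (fun y ↦ sharp y (P y) (β y)) (fun y ↦ sharp y (Q y) (γ y)) x) (α x)
    + pairing E x
      (bracketA (fun y ↦ sharp y (Q y) (β y)) (fun y ↦ sharp y (P y) (γ y)) x) (α x)
    - derivAlong (fun y ↦ (sharp y (P y) (α y)).1.1) (fun y ↦ bivEval y (Q y) (β y) (γ y)) x
    - derivAlong (fun y ↦ (sharp y (Q y) (α y)).1.1) (fun y ↦ bivEval y (P y) (β y) (γ y)) x

/-- The Schouten (Gerstenhaber) bracket `[P, Q]` of two sections of `∧² A`, evaluated on three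
sections of `A*`:
`[P, Q](α, β, γ) = ∑_cyc ⟨α, [P♯ β, Q♯ γ] + [Q♯ β, P♯ γ]⟩ - a(P♯ α) Q(β, γ) - a(Q♯ α) P(β, γ)`.
In a local frame `e_i` of `A` with vanishing brackets, and `P = ½ P^{ij} e_i ∧ e_j`,
`Q = ½ Q^{ij} e_i ∧ e_j`, the components of the right hand side are
`∑_cyc P^{il} a(e_l) Q^{jk} + Q^{il} a(e_l) P^{jk}`. -/
def schouten (P Q : Π x : X, ⋀[ℂ]^2 (A E x)) (α β γ : Π x : X, Astar E x) (x : X) : ℂ :=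
  schoutenTerm P Q α β γ x + schoutenTerm P Q β γ α x + schoutenTerm P Q γ α β x

variable (E X) in
/-- An extended Poisson structure: a smooth section `H` of `∧² A` that satisfies the
Maurer-Cartan equation `∂̄ H + ½ [H, H] = 0`. -/
structure ExtendedPoissonStructure where
  /-- The section of `∧² A`. -/
  H : Π x : X, ⋀[ℂ]^2 (A E x)
  smooth : ∀ α : Π x : X, Astar E x, IsSectionAstar α → IsSectionA (fun x ↦ sharp x (H x) (α x))
  maurerCartan : ∀ α β γ : Π x : X, Astar E x,
    IsSectionAstar α → IsSectionAstar β → IsSectionAstar γ →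
      ∀ x : X, dbar H α β γ x + 1 / 2 * schouten H H α β γ x = 0

namespace ExtendedPoissonStructure

variable (P : ExtendedPoissonStructure E X)

/-- The anchor `a_*^H = a_* + a ∘ H♯` of `A*_H`. -/
def anchor (x : X) (α : Astar E x) : TC E x := α.1.1 + (sharp x (P.H x) α).1.1

/-- The bracket `[α, β]_H = L_{H♯ α} β - L_{H♯ β} α - d ⟨H♯ α, β⟩`. -/
def bracketH (α β : Π x : X, Astar E x) (x : X) : Astar E x :=
  lieDerivAstar (fun y ↦ sharp y (P.H y) (α y)) β x
    - lieDerivAstar (fun y ↦ sharp y (P.H y) (β y)) α x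
    - dFun (fun y ↦ pairing E y (sharp y (P.H y) (α y)) (β y)) x

/-- The bracket `[α, β]_*^H = [α, β]_* + [α, β]_H` of `A*_H`. -/
def bracket (α β : Π x : X, Astar E x) (x : X) : Astar E x :=
  bracketAstar α β x + P.bracketH α β x

end ExtendedPoissonStructure

/-! ### Complex submanifolds -/

section Submanifold

variable {F : Type*} [NormedAddCommGroup F] [NormedSpace ℂ F]
  {Y : Type*} [TopologicalSpace Y] [ChartedSpace F Y]

variable (E F) in
/-- The complexified differential `T_ℂ,y Y → T_ℂ,ι(y) X` of a map `ι : Y → X`. -/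
def mfderivC (ι : Y → X) (y : Y) : TC F y →ₗ[ℂ] TC E (ι y) :=
  (mfderiv 𝓘(ℝ, F) 𝓘(ℝ, E) ι y).toLinearMap.baseChange ℂ

variable (E F) in
/-- The fibre at `y` of `K = T^{0,1} Y ⊕ N^{1,0} Y ⊆ A*|_Y`, where `N^{1,0} Y` is the annihilator
of `T^{1,0} Y` in `(T^{1,0} X)*`. -/
def K (ι : Y → X) (y : Y) : Submodule ℂ (Astar E (ι y)) where
  carrier := {α | α.1.1 ∈ (T01 F y).map (mfderivC E F ι y) ∧
    ∀ v ∈ T10 F y, evalC E (ι y) α.1.2 (mfderivC E F ι y v) = 0}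
  add_mem' := by
    intro a b ha hb
    refine ⟨?_, fun v hv ↦ ?_⟩
    · simpa using add_mem ha.1 hb.1
    · simp [ha.2 v hv, hb.2 v hv]
  zero_mem' := by
    refine ⟨?_, fun v _ ↦ ?_⟩
    · simp
    · simp
  smul_mem' := by
    intro c a ha
    refine ⟨?_, fun v hv ↦ ?_⟩
    · simpa using Submodule.smul_mem _ c ha.1
    · simp [ha.2 v hv]

variable (E F) in
/-- A smooth section of `K` over `Y`. -/
def IsSectionK (ι : Y → X) (u : Π y : Y, Astar E (ι y)) : Prop :=
  SmoothAlong F ι (fun y ↦ (u y).1) ∧ ∀ y, u y ∈ K E F ι y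

variable (F) in
/-- `Y` is coisotropic: `H(u, v) = 0` for all `u, v ∈ K`. -/
def IsCoisotropic (P : ExtendedPoissonStructure E X) (ι : Y → X) : Prop :=
  ∀ y : Y, ∀ u ∈ K E F ι y, ∀ v ∈ K E F ι y, bivEval (ι y) (P.H (ι y)) u v = 0

end Submanifold

end Manifold

end ExtendedPoisson

end

noncomputable section

set_option linter.unusedSectionVars false

/-! The proof takes place in `T_ℂ X ⊕ T*_ℂ X`, which contains both `A` and `A*`. Let `D` be the
bundle `T_ℂ Y ⊕ Ann(T_ℂ Y)` over `Y` (`tangentAnnihilator`). It is isotropic, it is stable under the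
projection to `A*` because `Y` is a complex submanifold, and it cuts out `K` in `A*` (`mem_K_iff`).
Coisotropy says that `H♯` maps `K` into the annihilator of `K` in `A`, and this annihilator lies in
`D` (`sharp_mem_tangentAnnihilator`). The claim on the anchor follows at once.

For the bracket, let `(V, η) ∘ (W, ζ) = ([V, W], L_V ζ - ι_W dη)` with `ι_W dη = L_W η - d(η(W))`.
Since `H♯` is skew, the exact terms recombine, and `[α, β]_*^H` becomes the `A*`-component of `α ∘ β
+ H♯α ∘ β + α ∘ H♯β` (`bracket_eq_projAstar`). Along `Y` all four sections `α`, `β`, `H♯α`, `H♯β`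
take values in `D`. Two facts finish the argument.

The operation `∘` preserves `D`: brackets of tangent fields are tangent, Lie derivatives along
tangent fields preserve conormal forms, and `η(W)` vanishes on `Y` (`bracket_mem_K`).

If the first factor is tangent to `Y`, then `∘` depends on the second factor only through its
restriction to `Y`: that factor is differentiated in tangent directions only, and `ι_W dη` is
pointwise in `W` (`bracket_congr_right`). Skew-symmetry of the bracket transfers this to the first
argument. -/

namespace ExtendedPoisson

open VectorField

/-! ### Real vector fields and their Lie bracket in the preferred charts -/

section RealCalculus

variable {E : Type*} [NormedAddCommGroup E] [NormedSpace ℝ E]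
  {X : Type*} [TopologicalSpace X] [ChartedSpace E X]
  {G : Type*} [NormedAddCommGroup G] [NormedSpace ℝ G]

lemma eventuallyEq_mvfderiv {f g : X → G} {x : X} (h : f =ᶠ[nhds x] g) :
    mvfderiv 𝓘(ℝ, E) f x = mvfderiv 𝓘(ℝ, E) g x := by
  unfold mvfderiv
  rw [h.mfderiv_eq, h.eq_of_nhds]

variable [IsManifold 𝓘(ℝ, E) ∞ X]

/-- A real vector field is smooth at a point. -/
abbrev SmoothVFAt (V : Π x : X, TangentSpace 𝓘(ℝ, E) x) (x : X) : Prop :=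
  ContMDiffAt 𝓘(ℝ, E) 𝓘(ℝ, E).tangent ∞ (fun y ↦ (⟨y, V y⟩ : TangentBundle 𝓘(ℝ, E) X)) x

/-- The coordinates of tangent vectors at `y` in the preferred chart at `x`. -/
def coordAt (x y : X) : TangentSpace 𝓘(ℝ, E) y →L[ℝ] E :=
  (tangentCoordChange 𝓘(ℝ, E) y x y : E →L[ℝ] E)

/-- The tangent vector at `y` with given coordinates in the preferred chart at `x`. -/
def coordSymmAt (x y : X) : E →L[ℝ] TangentSpace 𝓘(ℝ, E) y :=
  (tangentCoordChange 𝓘(ℝ, E) x y y : E →L[ℝ] E)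

lemma coordAt_coordSymmAt {x y : X} (hy : y ∈ (chartAt E x).source) (c : E) :
    coordAt x y (coordSymmAt x y c) = c := by
  have h1 : y ∈ (extChartAt 𝓘(ℝ, E) x).source := by rwa [extChartAt_source]
  have h2 := mem_extChartAt_source (I := 𝓘(ℝ, E)) y
  exact (tangentCoordChange_comp ⟨⟨h1, h2⟩, h1⟩).trans (tangentCoordChange_self h1)

lemma coordSymmAt_coordAt {x y : X} (hy : y ∈ (chartAt E x).source) (v : TangentSpace 𝓘(ℝ, E) y) :
    coordSymmAt x y (coordAt x y v) = v := by
  have h1 : y ∈ (extChartAt 𝓘(ℝ, E) x).source := by rwa [extChartAt_source]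
  have h2 := mem_extChartAt_source (I := 𝓘(ℝ, E)) y
  exact (tangentCoordChange_comp ⟨⟨h2, h1⟩, h2⟩).trans (tangentCoordChange_self h2)

/-- Links two descriptions of the same coordinates: the bundle trivialization, in which smoothness
is tested, and the differential of the chart, in which the Lie bracket is defined. -/
lemma mvfderiv_extChartAt_eq {x y : X} (hy : y ∈ (chartAt E x).source) :
    mvfderiv 𝓘(ℝ, E) (extChartAt 𝓘(ℝ, E) x) y = coordAt x y := by
  have h := TangentBundle.continuousLinearMapAt_trivializationAt (I := 𝓘(ℝ, E)) hy
  rw [TangentBundle.continuousLinearMapAt_trivializationAt_eq_core hy] at h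
  exact h.symm

lemma smoothVFAt_iff {V : Π x : X, TangentSpace 𝓘(ℝ, E) x} {x : X} :
    SmoothVFAt V x ↔
      ContMDiffAt 𝓘(ℝ, E) 𝓘(ℝ, E) ∞ (fun y ↦ coordAt x y (V y)) x :=
  contMDiffAt_section x

lemma SmoothVFAt.mvfderiv {V : Π x : X, TangentSpace 𝓘(ℝ, E) x} {x : X}
    (hV : SmoothVFAt V x) {f : X → G} (hf : ContMDiffAt 𝓘(ℝ, E) 𝓘(ℝ, G) ∞ f x) :
    ContMDiffAt 𝓘(ℝ, E) 𝓘(ℝ, G) ∞ (fun y ↦ mvfderiv 𝓘(ℝ, E) f y (V y)) x := by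
  have h1 := hf.mfderiv_const (m := ∞) (by simp)
  have h2 := ContMDiffAt.clm_apply_of_inCoordinates (b₁ := id) (b₂ := f) h1 hV hf
  exact (contMDiff_snd_tangentBundle_modelSpace G 𝓘(ℝ, G)).contMDiffAt.comp x h2

/-- In the preferred chart, the differential of a function is the Fréchet derivative. -/
lemma mvfderiv_eq_fderiv_comp {x y : X} (hy : y ∈ (chartAt E x).source) {f : X → G}
    (hf : MDifferentiableAt 𝓘(ℝ, E) 𝓘(ℝ, G) f y) (v : TangentSpace 𝓘(ℝ, E) y) :
    mvfderiv 𝓘(ℝ, E) f y v =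
      fderiv ℝ (f ∘ (extChartAt 𝓘(ℝ, E) x).symm) (extChartAt 𝓘(ℝ, E) x y) (coordAt x y v) := by
  have hy' : y ∈ (extChartAt 𝓘(ℝ, E) x).source := by rwa [extChartAt_source]
  have hinv := (extChartAt 𝓘(ℝ, E) x).left_inv hy'
  have ht := (extChartAt 𝓘(ℝ, E) x).map_source hy'
  have h1 : MDifferentiableAt 𝓘(ℝ, E) 𝓘(ℝ, E) (extChartAt 𝓘(ℝ, E) x).symm
      (extChartAt 𝓘(ℝ, E) x y) := by
    rw [← mdifferentiableWithinAt_univ]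
    have := mdifferentiableWithinAt_extChartAt_symm ht
    rwa [modelWithCornersSelf_coe, Set.range_id] at this
  have hF : MDifferentiableAt 𝓘(ℝ, E) 𝓘(ℝ, G) (f ∘ (extChartAt 𝓘(ℝ, E) x).symm)
      (extChartAt 𝓘(ℝ, E) x y) := by
    apply MDifferentiableAt.comp (I' := 𝓘(ℝ, E)) _ _ h1
    rwa [hinv]
  have hφ : MDifferentiableAt 𝓘(ℝ, E) 𝓘(ℝ, E) (extChartAt 𝓘(ℝ, E) x) y :=
    mdifferentiableAt_extChartAt hy
  have heq : f =ᶠ[nhds y] (f ∘ (extChartAt 𝓘(ℝ, E) x).symm) ∘ extChartAt 𝓘(ℝ, E) x := by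
    filter_upwards [(isOpen_extChartAt_source (I := 𝓘(ℝ, E)) x).mem_nhds hy'] with z hz
    exact congrArg f ((extChartAt 𝓘(ℝ, E) x).left_inv hz).symm
  have h2 : mvfderiv 𝓘(ℝ, E) f y =
      mvfderiv 𝓘(ℝ, E) ((f ∘ (extChartAt 𝓘(ℝ, E) x).symm) ∘ extChartAt 𝓘(ℝ, E) x) y := by
    unfold mvfderiv
    rw [heq.mfderiv_eq]
    rfl
  rw [h2, ← mvfderiv_extChartAt_eq hy]
  refine (mfderiv_comp_apply y hF hφ v).trans ?_
  rw [← mfderiv_eq_fderiv]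
  rfl

/-- Functions of the form `h ∘ φ` for the preferred chart `φ` at `x`. -/
lemma mvfderiv_comp_extChartAt {x : X} {h : E → G}
    (hh : DifferentiableAt ℝ h (extChartAt 𝓘(ℝ, E) x x)) (v : TangentSpace 𝓘(ℝ, E) x) :
    mvfderiv 𝓘(ℝ, E) (fun y ↦ h (extChartAt 𝓘(ℝ, E) x y)) x v =
      fderiv ℝ h (extChartAt 𝓘(ℝ, E) x x) (coordAt x x v) := by
  have hφ : MDifferentiableAt 𝓘(ℝ, E) 𝓘(ℝ, E) (extChartAt 𝓘(ℝ, E) x) x :=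
    mdifferentiableAt_extChartAt (mem_chart_source E x)
  rw [← mvfderiv_extChartAt_eq (mem_chart_source E x)]
  refine (mfderiv_comp_apply x hh.mdifferentiableAt hφ v).trans ?_
  rw [← mfderiv_eq_fderiv]
  rfl

lemma contMDiffAt_extChartAt_symm_self (x : X) :
    ContMDiffAt 𝓘(ℝ, E) 𝓘(ℝ, E) ∞ (extChartAt 𝓘(ℝ, E) x).symm (extChartAt 𝓘(ℝ, E) x x) := by
  have := contMDiffWithinAt_extChartAt_symm_range (I := 𝓘(ℝ, E)) (n := ∞) x
    (mem_extChartAt_target x)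
  rwa [modelWithCornersSelf_coe, Set.range_id, contMDiffWithinAt_univ] at this

/-- The expression of a vector field in the preferred chart at `x`. -/
def inChart (x : X) (V : Π x : X, TangentSpace 𝓘(ℝ, E) x) (z : E) : E :=
  coordAt x ((extChartAt 𝓘(ℝ, E) x).symm z) (V ((extChartAt 𝓘(ℝ, E) x).symm z))

lemma inChart_extChartAt {x y : X} (hy : y ∈ (chartAt E x).source)
    (V : Π x : X, TangentSpace 𝓘(ℝ, E) x) :
    inChart x V (extChartAt 𝓘(ℝ, E) x y) = coordAt x y (V y) := by
  have hy' : y ∈ (extChartAt 𝓘(ℝ, E) x).source := by rwa [extChartAt_source]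
  rw [inChart, (extChartAt 𝓘(ℝ, E) x).left_inv hy']

lemma SmoothVFAt.differentiableAt_inChart {x : X} {V : Π x : X, TangentSpace 𝓘(ℝ, E) x}
    (hV : SmoothVFAt V x) : DifferentiableAt ℝ (inChart x V) (extChartAt 𝓘(ℝ, E) x x) := by
  have h1 := contMDiffAt_extChartAt_symm_self (E := E) x
  have h2 : ContMDiffAt 𝓘(ℝ, E) 𝓘(ℝ, E) ∞ (inChart x V) (extChartAt 𝓘(ℝ, E) x x) := by
    exact ContMDiffAt.comp_of_eq (I' := 𝓘(ℝ, E)) (smoothVFAt_iff.1 hV) h1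
      (extChartAt_to_inv (I := 𝓘(ℝ, E)) x)
  exact h2.contDiffAt.differentiableAt (by simp)

/-- `mlieBracket` is defined through the pullback by the inverse chart. The differential of the
chart inverts that of the inverse chart, so this pullback is the coordinate expression. -/
lemma eventuallyEq_mpullback_inChart (x : X) (V : Π x : X, TangentSpace 𝓘(ℝ, E) x) :
    mpullbackWithin 𝓘(ℝ, E) 𝓘(ℝ, E) (extChartAt 𝓘(ℝ, E) x).symm V (Set.range 𝓘(ℝ, E))
      =ᶠ[nhds (extChartAt 𝓘(ℝ, E) x x)] inChart x V := by
  filter_upwards [extChartAt_target_mem_nhds (I := 𝓘(ℝ, E)) x] with z hz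
  have hy : (extChartAt 𝓘(ℝ, E) x).symm z ∈ (chartAt E x).source := by
    rw [← extChartAt_source (I := 𝓘(ℝ, E))]
    exact (extChartAt 𝓘(ℝ, E) x).map_target hz
  rw [mpullbackWithin_apply, inChart, ← mvfderiv_extChartAt_eq hy]
  have hinv := isInvertible_mfderivWithin_extChartAt_symm (I := 𝓘(ℝ, E)) hz
  have h2 := mfderiv_extChartAt_comp_mfderivWithin_extChartAt_symm (I := 𝓘(ℝ, E)) hz
  obtain ⟨w, hw⟩ := hinv.surjective (V ((extChartAt 𝓘(ℝ, E) x).symm z))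
  have h3 := DFunLike.congr_fun h2 w
  rw [← hw, hinv.inverse_apply_self]
  exact h3.symm

lemma coordAt_mlieBracket [CompleteSpace E] {x : X} (V W : Π x : X, TangentSpace 𝓘(ℝ, E) x) :
    coordAt x x (mlieBracket 𝓘(ℝ, E) V W x) =
      fderiv ℝ (inChart x W) (extChartAt 𝓘(ℝ, E) x x) (coordAt x x (V x))
        - fderiv ℝ (inChart x V) (extChartAt 𝓘(ℝ, E) x x) (coordAt x x (W x)) := by
  have hx := mem_chart_source E x
  rw [← mlieBracketWithin_univ, mlieBracketWithin_apply, ← mvfderiv_extChartAt_eq hx]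
  have hinv := isInvertible_mfderiv_extChartAt (I := 𝓘(ℝ, E)) (mem_extChartAt_source x)
  refine (hinv.self_apply_inverse _).trans ?_
  rw [Filter.EventuallyEq.lieBracketWithin_vectorField_eq_nhds
    (eventuallyEq_mpullback_inChart x V) (eventuallyEq_mpullback_inChart x W)]
  rw [Set.preimage_univ, Set.univ_inter, modelWithCornersSelf_coe, Set.range_id]
  rw [lieBracketWithin_univ, lieBracket, inChart_extChartAt hx, inChart_extChartAt hx,
    mvfderiv_extChartAt_eq hx]

/-- The Lie bracket of vector fields as a commutator of derivations. -/
theorem mvfderiv_mlieBracket [CompleteSpace E] {f : X → G} {x : X}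
    (hf : ContMDiffAt 𝓘(ℝ, E) 𝓘(ℝ, G) ∞ f x) {V W : Π x : X, TangentSpace 𝓘(ℝ, E) x}
    (hV : SmoothVFAt V x) (hW : SmoothVFAt W x) :
    mvfderiv 𝓘(ℝ, E) f x (mlieBracket 𝓘(ℝ, E) V W x) =
      mvfderiv 𝓘(ℝ, E) (fun y ↦ mvfderiv 𝓘(ℝ, E) f y (W y)) x (V x)
        - mvfderiv 𝓘(ℝ, E) (fun y ↦ mvfderiv 𝓘(ℝ, E) f y (V y)) x (W x) := by
  set φ := extChartAt 𝓘(ℝ, E) x with hφdef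
  set F := f ∘ φ.symm with hF
  have hFd : ContDiffAt ℝ ∞ F (φ x) := by
    have h1 := contMDiffAt_extChartAt_symm_self (E := E) x
    refine ContMDiffAt.contDiffAt (ContMDiffAt.comp (I' := 𝓘(ℝ, E)) _ ?_ h1)
    rwa [extChartAt_to_inv]
  have hsrc : ∀ᶠ y in nhds x, y ∈ (chartAt E x).source := chart_source_mem_nhds E x
  have hfd : ∀ᶠ y in nhds x, MDifferentiableAt 𝓘(ℝ, E) 𝓘(ℝ, G) f y := by
    have h1 : ContMDiffAt 𝓘(ℝ, E) 𝓘(ℝ, G) 1 f x := hf.of_le (by simp)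
    have h2 := (contMDiffAt_iff_contMDiffAt_nhds (by simp)).1 h1
    exact h2.mono fun y hy ↦ hy.mdifferentiableAt (by simp)
  -- In coordinates `V(W f) = D²F(V, W) + DF(D_V W)`. The second derivative is symmetric and drops
  -- out of the commutator; what remains is `DF` applied to the coordinate bracket.
  have key : ∀ {V W : Π x : X, TangentSpace 𝓘(ℝ, E) x}, SmoothVFAt W x →
      mvfderiv 𝓘(ℝ, E) (fun y ↦ mvfderiv 𝓘(ℝ, E) f y (W y)) x (V x) =
        fderiv ℝ (fderiv ℝ F) (φ x) (coordAt x x (V x)) (coordAt x x (W x))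
          + fderiv ℝ F (φ x) (fderiv ℝ (inChart x W) (φ x) (coordAt x x (V x))) := by
    intro V W hW
    have h1 : (fun y ↦ mvfderiv 𝓘(ℝ, E) f y (W y)) =ᶠ[nhds x]
        fun y ↦ (fun z ↦ fderiv ℝ F z (inChart x W z)) (φ y) := by
      filter_upwards [hsrc, hfd] with y hy hy2
      rw [mvfderiv_eq_fderiv_comp hy hy2, hφdef, inChart_extChartAt hy]
    have h2 : DifferentiableAt ℝ (fderiv ℝ F) (φ x) :=
      (hFd.fderiv_right (m := 1) (WithTop.coe_le_coe.2 le_top)).differentiableAt (by simp)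
    have h3 := hW.differentiableAt_inChart
    rw [eventuallyEq_mvfderiv h1, mvfderiv_comp_extChartAt (h2.clm_apply h3),
      fderiv_clm_apply h2 h3]
    simp only [add_apply, ContinuousLinearMap.comp_apply, ContinuousLinearMap.flip_apply]
    rw [hφdef, inChart_extChartAt (mem_chart_source E x), add_comm]
  have hsymm : IsSymmSndFDerivAt ℝ F (φ x) :=
    (hFd.of_le (m := 2) (WithTop.coe_le_coe.2 le_top)).isSymmSndFDerivAt (by simp)
  rw [key hV, key hW, hsymm.eq (coordAt x x (W x)), add_sub_add_left_eq_sub, ← map_sub,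
    mvfderiv_eq_fderiv_comp (mem_chart_source E x) hfd.self_of_nhds, coordAt_mlieBracket]

end RealCalculus

/-! ### Real and imaginary parts of complexified vectors -/

section ComplexLinearAlgebra

variable {V : Type*} [AddCommGroup V] [Module ℝ V]

@[simp] lemma rePart_tmul (z : ℂ) (v : V) : rePart (z ⊗ₜ[ℝ] v) = z.re • v := by
  simp [rePart]

@[simp] lemma imPart_tmul (z : ℂ) (v : V) : imPart (z ⊗ₜ[ℝ] v) = z.im • v := by
  simp [imPart]

@[simp] lemma rePart_ofReIm (v w : V) : rePart (ofReIm v w) = v := by simp [ofReIm]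

@[simp] lemma imPart_ofReIm (v w : V) : imPart (ofReIm v w) = w := by simp [ofReIm]

lemma ofReIm_add (v w v' w' : V) : ofReIm (v + v') (w + w') = ofReIm v w + ofReIm v' w' := by
  simp only [ofReIm, TensorProduct.tmul_add]
  abel

lemma ofReIm_rePart_imPart (t : ℂ ⊗[ℝ] V) : ofReIm (rePart t) (imPart t) = t := by
  induction t using TensorProduct.induction_on with
  | zero => simp [ofReIm]
  | tmul z v =>
    simp only [ofReIm, rePart_tmul, imPart_tmul, ← TensorProduct.smul_tmul, ← TensorProduct.add_tmul]
    congr 1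
    rw [Complex.real_smul, Complex.real_smul, mul_one]
    exact Complex.re_add_im z
  | add a b ha hb => rw [map_add, map_add, ofReIm_add, ha, hb]

lemma complexified_ext {s t : ℂ ⊗[ℝ] V} (h1 : rePart s = rePart t) (h2 : imPart s = imPart t) :
    s = t := by
  rw [← ofReIm_rePart_imPart s, h1, h2, ofReIm_rePart_imPart]

lemma rePart_smul (c : ℂ) (t : ℂ ⊗[ℝ] V) :
    rePart (c • t) = c.re • rePart t - c.im • imPart t := by
  induction t using TensorProduct.induction_on with
  | zero => simp
  | tmul z v => simp [TensorProduct.smul_tmul', sub_smul, mul_smul]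
  | add a b ha hb => rw [smul_add, map_add, ha, hb, map_add, map_add, smul_add, smul_add]; abel

lemma imPart_smul (c : ℂ) (t : ℂ ⊗[ℝ] V) :
    imPart (c • t) = c.re • imPart t + c.im • rePart t := by
  induction t using TensorProduct.induction_on with
  | zero => simp
  | tmul z v => simp [TensorProduct.smul_tmul', add_smul, mul_smul]
  | add a b ha hb => rw [smul_add, map_add, ha, hb, map_add, map_add, smul_add, smul_add]; abel

variable {W : Type*} [AddCommGroup W] [Module ℝ W]

lemma rePart_baseChange (f : V →ₗ[ℝ] W) (t : ℂ ⊗[ℝ] V) :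
    rePart (f.baseChange ℂ t) = f (rePart t) := by
  induction t using TensorProduct.induction_on with
  | zero => simp
  | tmul z v => simp
  | add a b ha hb => simp [ha, hb]

lemma imPart_baseChange (f : V →ₗ[ℝ] W) (t : ℂ ⊗[ℝ] V) :
    imPart (f.baseChange ℂ t) = f (imPart t) := by
  induction t using TensorProduct.induction_on with
  | zero => simp
  | tmul z v => simp
  | add a b ha hb => simp [ha, hb]

lemma baseChange_ofReIm (f : V →ₗ[ℝ] W) (v w : V) :
    f.baseChange ℂ (ofReIm v w) = ofReIm (f v) (f w) := by
  simp [ofReIm]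

/-- A complexified vector lies in the range of a complexified map iff its parts lie in the range
of the map. -/
lemma mem_range_baseChange_iff (f : V →ₗ[ℝ] W) (t : ℂ ⊗[ℝ] W) :
    t ∈ LinearMap.range (f.baseChange ℂ) ↔
      rePart t ∈ LinearMap.range f ∧ imPart t ∈ LinearMap.range f := by
  constructor
  · rintro ⟨s, rfl⟩
    exact ⟨⟨rePart s, (rePart_baseChange f s).symm⟩, ⟨imPart s, (imPart_baseChange f s).symm⟩⟩
  · rintro ⟨⟨a, ha⟩, ⟨b, hb⟩⟩
    exact ⟨ofReIm a b, by rw [baseChange_ofReIm, ha, hb, ofReIm_rePart_imPart]⟩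

end ComplexLinearAlgebra

/-! ### Complex one-forms and Lie derivatives along real vector fields -/

section Forms

variable {E : Type*} [NormedAddCommGroup E] [NormedSpace ℂ E]
  {X : Type*} [TopologicalSpace X] [ChartedSpace E X]

lemma evalC_eq (x : X) (η : CotC E x) (t : TC E x) :
    evalC E x η t = η (rePart t) + Complex.I * η (imPart t) := by
  induction t using TensorProduct.induction_on with
  | zero => simp
  | tmul z v =>
    have h : evalC E x η (z ⊗ₜ[ℝ] v) = z * η v := by
      simp [evalC]
    simp only [h, rePart_tmul, imPart_tmul, map_smul, Complex.real_smul]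
    linear_combination (-η v) * (Complex.re_add_im z)
  | add a b ha hb => simp only [map_add, ha, hb]; ring

lemma rePart_JC (x : X) (t : TC E x) : rePart (JC E x t) = J E x (rePart t) :=
  rePart_baseChange _ t

lemma imPart_JC (x : X) (t : TC E x) : imPart (JC E x t) = J E x (imPart t) :=
  imPart_baseChange _ t

variable [FiniteDimensional ℂ E]

lemma contMDiffAt_clm_of_apply {x : X} {f : X → E →L[ℝ] ℂ}
    (h : ∀ c : E, ContMDiffAt 𝓘(ℝ, E) 𝓘(ℝ, ℂ) ∞ (fun y ↦ f y c) x) :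
    ContMDiffAt 𝓘(ℝ, E) 𝓘(ℝ, E →L[ℝ] ℂ) ∞ f x := by
  have : FiniteDimensional ℝ E := FiniteDimensional.complexToReal E
  let d := Module.finrank ℝ E
  have hd : d = Module.finrank ℝ (Fin d → ℝ) := (Module.finrank_fin_fun ℝ).symm
  let e₁ := ContinuousLinearEquiv.ofFinrankEq hd
  let e₂ := (e₁.arrowCongr (1 : ℂ ≃L[ℝ] ℂ)).trans (ContinuousLinearEquiv.piRing (Fin d))
  rw [← Function.id_comp f, ← e₂.symm_comp_self]
  exact e₂.symm.contDiff.contMDiff.contMDiffAt.comp x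
    (contMDiffAt_pi_space.2 fun i ↦ h _)

/-- A complex one-form is smooth at a point. -/
abbrev SmoothFormAt [IsManifold 𝓘(ℂ, E) ω X] (η : Π x : X, CotC E x) (x : X) : Prop :=
  ContMDiffAt 𝓘(ℝ, E) (𝓘(ℝ, E).prod 𝓘(ℝ, E →L[ℝ] ℂ)) ∞
    (fun y ↦ TotalSpace.mk' (E →L[ℝ] ℂ)
      (E := fun x : X ↦ TangentSpace 𝓘(ℝ, E) x →L[ℝ] Trivial X ℂ x) y (toCLM y (η y))) x

variable [IsManifold 𝓘(ℂ, E) ω X]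

/-- The expression of a one-form in the preferred chart at `x`. -/
def formHat (x : X) (η : Π x : X, CotC E x) (y : X) : E →L[ℝ] ℂ :=
  (toCLM y (η y)).comp (coordSymmAt x y)

lemma formHat_apply (x : X) (η : Π x : X, CotC E x) (y : X) (c : E) :
    formHat x η y c = η y (coordSymmAt x y c) := rfl

lemma formHat_coordAt {x y : X} (hy : y ∈ (chartAt E x).source) (η : Π x : X, CotC E x)
    (v : TangentSpace 𝓘(ℝ, E) y) : formHat x η y (coordAt x y v) = η y v := by
  rw [formHat_apply, coordSymmAt_coordAt hy]

lemma smoothFormAt_iff {η : Π x : X, CotC E x} {x : X} :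
    SmoothFormAt η x ↔ ContMDiffAt 𝓘(ℝ, E) 𝓘(ℝ, E →L[ℝ] ℂ) ∞ (formHat x η) x := by
  rw [SmoothFormAt, contMDiffAt_hom_bundle]
  have h : (fun y ↦ ContinuousLinearMap.inCoordinates E (TangentSpace 𝓘(ℝ, E)) ℂ (Trivial X ℂ)
      x y x y (toCLM y (η y))) =ᶠ[nhds x] formHat x η := by
    filter_upwards [chart_source_mem_nhds E x] with y hy
    ext c
    have h2 := DFunLike.congr_fun
      (TangentBundle.symmL_trivializationAt_eq_core (I := 𝓘(ℝ, E)) hy) c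
    have h3 : (trivializationAt ℂ (Trivial X ℂ) x).continuousLinearMapAt ℝ y =
        ContinuousLinearMap.id ℝ ℂ := Trivial.continuousLinearMapAt_trivialization ℝ X ℂ y
    unfold ContinuousLinearMap.inCoordinates
    rw [h3]
    exact congrArg (toCLM y (η y)) h2
  constructor
  · rintro ⟨-, h2⟩
    exact h2.congr_of_eventuallyEq h.symm
  · intro h2
    exact ⟨contMDiffAt_id, h2.congr_of_eventuallyEq h⟩

lemma SmoothFormAt.apply {η : Π x : X, CotC E x} {x : X} (hη : SmoothFormAt η x)
    {V : Π x : X, TangentSpace 𝓘(ℝ, E) x} (hV : SmoothVFAt V x) :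
    ContMDiffAt 𝓘(ℝ, E) 𝓘(ℝ, ℂ) ∞ (fun y ↦ η y (V y)) x := by
  refine ((smoothFormAt_iff.1 hη).clm_apply (smoothVFAt_iff.1 hV)).congr_of_eventuallyEq ?_
  filter_upwards [chart_source_mem_nhds E x] with y hy
  exact (formHat_coordAt hy η (V y)).symm

/-- The fields with constant coefficients in the chart at `x` serve as test fields for one-forms.
Smoothness is needed at every `y` of the chart domain, because the formula for the Lie derivative is
applied at all points near `x`. -/
lemma smoothVFAt_coordSymmAt {x y : X} (hy : y ∈ (chartAt E x).source) (c : E) :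
    SmoothVFAt (fun z : X ↦ coordSymmAt x z c) y := by
  have hb : y ∈ (trivializationAt E (TangentSpace 𝓘(ℝ, E)) x).baseSet := by simpa using hy
  refine ((trivializationAt E (TangentSpace 𝓘(ℝ, E)) x).contMDiffAt_section_iff hb).2 ?_
  refine (contMDiffAt_const (c := c)).congr_of_eventuallyEq ?_
  filter_upwards [(chartAt E x).open_source.mem_nhds hy] with z hz
  exact coordAt_coordSymmAt hz c

lemma smoothFormAt_of_apply {η : Π x : X, CotC E x} {x : X}
    (h : ∀ c : E, ContMDiffAt 𝓘(ℝ, E) 𝓘(ℝ, ℂ) ∞ (fun y ↦ η y (coordSymmAt x y c)) x) :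
    SmoothFormAt η x :=
  smoothFormAt_iff.2 (contMDiffAt_clm_of_apply h)

lemma differentiableAt_comp_extChartAt_symm {G : Type*} [NormedAddCommGroup G] [NormedSpace ℝ G]
    {x : X} {f : X → G} (hf : MDifferentiableAt 𝓘(ℝ, E) 𝓘(ℝ, G) f x) :
    DifferentiableAt ℝ (f ∘ (extChartAt 𝓘(ℝ, E) x).symm) (extChartAt 𝓘(ℝ, E) x x) := by
  have h1 := (contMDiffAt_extChartAt_symm_self (E := E) x).mdifferentiableAt (by simp)
  refine (MDifferentiableAt.comp (I' := 𝓘(ℝ, E)) _ ?_ h1).differentiableAt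
  rwa [extChartAt_to_inv]

lemma mvfderiv_clm_apply {G : Type*} [NormedAddCommGroup G] [NormedSpace ℝ G] {x : X}
    {g : X → E →L[ℝ] G} {h : X → E} (hg : MDifferentiableAt 𝓘(ℝ, E) 𝓘(ℝ, E →L[ℝ] G) g x)
    (hh : MDifferentiableAt 𝓘(ℝ, E) 𝓘(ℝ, E) h x) (v : TangentSpace 𝓘(ℝ, E) x) :
    mvfderiv 𝓘(ℝ, E) (fun y ↦ g y (h y)) x v =
      mvfderiv 𝓘(ℝ, E) g x v (h x) + g x (mvfderiv 𝓘(ℝ, E) h x v) := by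
  have hx := mem_chart_source E x
  rw [mvfderiv_eq_fderiv_comp hx (hg.clm_apply hh), mvfderiv_eq_fderiv_comp hx hg,
    mvfderiv_eq_fderiv_comp hx hh]
  have h3 := fderiv_clm_apply (differentiableAt_comp_extChartAt_symm hg)
    (differentiableAt_comp_extChartAt_symm hh)
  simp only [Function.comp_apply, extChartAt_to_inv] at h3
  refine (DFunLike.congr_fun h3 _).trans ?_
  simp [add_comm]

lemma coordAt_self (x : X) (v : TangentSpace 𝓘(ℝ, E) x) : coordAt x x v = tangentId x v :=
  tangentCoordChange_self (mem_extChartAt_source x)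

lemma coordSymmAt_self (x : X) (c : E) : coordSymmAt x x c = (tangentId x).symm c := by
  have h : tangentCoordChange 𝓘(ℝ, E) x x x c = c :=
    tangentCoordChange_self (mem_extChartAt_source x)
  exact h

lemma lieDerivReal_eq (W : Π x : X, TangentSpace 𝓘(ℝ, E) x) (η : Π x : X, CotC E x) (x : X)
    (v : TangentSpace 𝓘(ℝ, E) x) :
    lieDerivReal W η x v = mvfderiv 𝓘(ℝ, E) (formHat x η) x (W x) (coordAt x x v)
      + formHat x η x (mvfderiv 𝓘(ℝ, E) (fun y ↦ coordAt x y (W y)) x v) := by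
  rw [coordAt_self, formHat_apply, coordSymmAt_self]
  rfl

lemma coordAt_mlieBracket_eq {W Z : Π x : X, TangentSpace 𝓘(ℝ, E) x} {x : X}
    (hW : SmoothVFAt W x) (hZ : SmoothVFAt Z x) :
    coordAt x x (mlieBracket 𝓘(ℝ, E) W Z x) =
      mvfderiv 𝓘(ℝ, E) (fun y ↦ coordAt x y (Z y)) x (W x)
        - mvfderiv 𝓘(ℝ, E) (fun y ↦ coordAt x y (W y)) x (Z x) := by
  have : CompleteSpace E := FiniteDimensional.complete ℂ E
  have h := mvfderiv_mlieBracket (contMDiffAt_extChartAt (I := 𝓘(ℝ, E)) (n := ∞) (x := x)) hW hZ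
  have key : ∀ V : Π x : X, TangentSpace 𝓘(ℝ, E) x,
      (fun y ↦ mvfderiv 𝓘(ℝ, E) (extChartAt 𝓘(ℝ, E) x) y (V y)) =ᶠ[nhds x]
        fun y ↦ coordAt x y (V y) := by
    intro V
    filter_upwards [chart_source_mem_nhds E x] with y hy
    rw [mvfderiv_extChartAt_eq hy]
  rw [eventuallyEq_mvfderiv (key Z), eventuallyEq_mvfderiv (key W),
    mvfderiv_extChartAt_eq (mem_chart_source E x)] at h
  exact h

/-- The Lie derivative of a one-form, evaluated on a vector field. -/
theorem lieDerivReal_apply {W Z : Π x : X, TangentSpace 𝓘(ℝ, E) x} {η : Π x : X, CotC E x} {x : X}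
    (hW : SmoothVFAt W x) (hη : SmoothFormAt η x) (hZ : SmoothVFAt Z x) :
    lieDerivReal W η x (Z x) = mvfderiv 𝓘(ℝ, E) (fun y ↦ η y (Z y)) x (W x)
      - η x (mlieBracket 𝓘(ℝ, E) W Z x) := by
  have h1 : (fun y ↦ η y (Z y)) =ᶠ[nhds x] fun y ↦ formHat x η y (coordAt x y (Z y)) := by
    filter_upwards [chart_source_mem_nhds E x] with y hy
    rw [formHat_coordAt hy]
  rw [eventuallyEq_mvfderiv h1, mvfderiv_clm_apply
    ((smoothFormAt_iff.1 hη).mdifferentiableAt (by simp))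
    ((smoothVFAt_iff.1 hZ).mdifferentiableAt (by simp)),
    ← formHat_coordAt (mem_chart_source E x) η (mlieBracket 𝓘(ℝ, E) W Z x),
    coordAt_mlieBracket_eq hW hZ, lieDerivReal_eq, map_sub]
  ring

lemma smoothVFAt_mlieBracket {V W : Π x : X, TangentSpace 𝓘(ℝ, E) x} {x : X}
    (hV : SmoothVFAt V x) (hW : SmoothVFAt W x) : SmoothVFAt (mlieBracket 𝓘(ℝ, E) V W) x := by
  have : CompleteSpace E := FiniteDimensional.complete ℂ E
  exact ContMDiffAt.mlieBracket_vectorField (n := ⊤) (m := ⊤) hV hW (by simp)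

/-- The definition of `lieDerivReal` uses a chart that changes with the point, so it does not show
smoothness. The invariant formula `lieDerivReal_apply`, tested on a frame that is constant in one
fixed chart, does. -/
lemma smoothFormAt_lieDerivReal {W : Π x : X, TangentSpace 𝓘(ℝ, E) x} {η : Π x : X, CotC E x}
    (hW : ∀ x, SmoothVFAt W x) (hη : ∀ x, SmoothFormAt η x) (x : X) :
    SmoothFormAt (lieDerivReal W η) x := by
  refine smoothFormAt_of_apply fun c ↦ ?_
  have hx := mem_chart_source E x
  have hZ := smoothVFAt_coordSymmAt hx c
  have h1 := ((hW x).mvfderiv ((hη x).apply hZ)).sub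
    ((hη x).apply (smoothVFAt_mlieBracket (hW x) hZ))
  refine h1.congr_of_eventuallyEq ?_
  filter_upwards [chart_source_mem_nhds E x] with y hy
  exact lieDerivReal_apply (hW y) (hη y) (smoothVFAt_coordSymmAt hy c)

lemma smoothFormAt_dC {f : X → ℂ} {x : X} (hf : ContMDiffAt 𝓘(ℝ, E) 𝓘(ℝ, ℂ) ∞ f x) :
    SmoothFormAt (dC (E := E) f) x :=
  smoothFormAt_of_apply fun c ↦ (smoothVFAt_coordSymmAt (mem_chart_source E x) c).mvfderiv hf

end Forms

/-! ### Holomorphic maps as real smooth maps -/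

section Holomorphic

variable {E : Type*} [NormedAddCommGroup E] [NormedSpace ℂ E]
  {X : Type*} [TopologicalSpace X] [ChartedSpace E X]
  {F : Type*} [NormedAddCommGroup F] [NormedSpace ℂ F]
  {Y : Type*} [TopologicalSpace Y] [ChartedSpace F Y]

lemma HasMFDerivAt.restrictScalars_real {f : Y → X} {y : Y}
    {f' : TangentSpace 𝓘(ℂ, F) y →L[ℂ] TangentSpace 𝓘(ℂ, E) (f y)}
    (h : HasMFDerivAt 𝓘(ℂ, F) 𝓘(ℂ, E) f y f') :
    HasMFDerivAt 𝓘(ℝ, F) 𝓘(ℝ, E) f y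
      ((f' : F →L[ℂ] E).restrictScalars ℝ : F →L[ℝ] E) :=
  ⟨h.1, HasFDerivWithinAt.restrictScalars ℝ h.2⟩

lemma ContMDiffAt.restrictScalars_real {f : Y → X} {y : Y} {n : ℕ∞ω}
    (h : ContMDiffAt 𝓘(ℂ, F) 𝓘(ℂ, E) n f y) : ContMDiffAt 𝓘(ℝ, F) 𝓘(ℝ, E) n f y := by
  rw [contMDiffAt_iff] at h ⊢
  exact ⟨h.1, ContDiffWithinAt.restrict_scalars ℝ h.2⟩

/-- The differential of a holomorphic map commutes with the complex structures. -/
lemma mfderiv_J {f : Y → X} {y : Y} (h : MDifferentiableAt 𝓘(ℂ, F) 𝓘(ℂ, E) f y)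
    (v : TangentSpace 𝓘(ℝ, F) y) :
    mfderiv 𝓘(ℝ, F) 𝓘(ℝ, E) f y (J F y v) = J E (f y) (mfderiv 𝓘(ℝ, F) 𝓘(ℝ, E) f y v) := by
  rw [(HasMFDerivAt.restrictScalars_real h.hasMFDerivAt).mfderiv]
  exact ((mfderiv 𝓘(ℂ, F) 𝓘(ℂ, E) f y : F →L[ℂ] E)).map_smul Complex.I v

lemma mfderivC_JC {f : Y → X} {y : Y} (h : MDifferentiableAt 𝓘(ℂ, F) 𝓘(ℂ, E) f y)
    (v : TC F y) : mfderivC E F f y (JC F y v) = JC E (f y) (mfderivC E F f y v) := by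
  apply complexified_ext
  · rw [rePart_JC]
    exact (rePart_baseChange _ _).trans (by
      rw [rePart_JC]
      refine (mfderiv_J h _).trans (congrArg _ ?_)
      exact (rePart_baseChange _ _).symm)
  · rw [imPart_JC]
    exact (imPart_baseChange _ _).trans (by
      rw [imPart_JC]
      refine (mfderiv_J h _).trans (congrArg _ ?_)
      exact (imPart_baseChange _ _).symm)

end Holomorphic

/-! ### Smoothness of the operations on sections of `A` and `A*` -/

section Smoothness

variable {E : Type*} [NormedAddCommGroup E] [NormedSpace ℂ E] [FiniteDimensional ℂ E]
  {X : Type*} [TopologicalSpace X] [ChartedSpace E X] [IsManifold 𝓘(ℂ, E) ω X]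

/-- `J` at `y` is multiplication by `i` in the preferred chart at `y`. The chart at `x` is
holomorphic, so its differential at `y` is complex linear. -/
lemma coordAt_J {x y : X} (hy : y ∈ (chartAt E x).source) (v : TangentSpace 𝓘(ℝ, E) y) :
    coordAt x y (J E y v) = Complex.I • coordAt x y v := by
  have : IsManifold 𝓘(ℂ, E) 1 X := IsManifold.of_le (n := ω) (by simp)
  have h : MDifferentiableAt 𝓘(ℂ, E) 𝓘(ℂ, E) (extChartAt 𝓘(ℝ, E) x) y :=
    mdifferentiableAt_extChartAt (I := 𝓘(ℂ, E)) hy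
  rw [← mvfderiv_extChartAt_eq hy]
  exact mfderiv_J h v

variable {V W : Π x : X, TangentSpace 𝓘(ℝ, E) x} {η ζ : Π x : X, CotC E x} {x : X}

lemma SmoothVFAt.J (hV : SmoothVFAt V x) : SmoothVFAt (fun y ↦ J E y (V y)) x := by
  rw [smoothVFAt_iff] at hV ⊢
  have h : ContMDiff 𝓘(ℝ, E) 𝓘(ℝ, E) ∞ (fun c : E ↦ Complex.I • c) :=
    (contDiff_const_smul Complex.I).contMDiff
  refine (h.contMDiffAt.comp x hV).congr_of_eventuallyEq ?_
  filter_upwards [chart_source_mem_nhds E x] with y hy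
  exact coordAt_J hy _

lemma SmoothVFAt.add (hV : SmoothVFAt V x) (hW : SmoothVFAt W x) :
    SmoothVFAt (fun y ↦ V y + W y) x := by
  rw [smoothVFAt_iff] at hV hW ⊢
  simpa only [map_add] using! hV.add hW

lemma SmoothVFAt.sub (hV : SmoothVFAt V x) (hW : SmoothVFAt W x) :
    SmoothVFAt (fun y ↦ V y - W y) x := by
  rw [smoothVFAt_iff] at hV hW ⊢
  simpa only [map_sub] using! hV.sub hW

lemma SmoothVFAt.const_smul (r : ℝ) (hV : SmoothVFAt V x) :
    SmoothVFAt (fun y ↦ r • V y) x := by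
  rw [smoothVFAt_iff] at hV ⊢
  have h : ContMDiff 𝓘(ℝ, E) 𝓘(ℝ, E) ∞ (fun c : E ↦ r • c) := (contDiff_const_smul r).contMDiff
  simpa only [map_smul] using! h.contMDiffAt.comp x hV

lemma SmoothFormAt.comp_J (hη : SmoothFormAt η x) : SmoothFormAt (fun y ↦ η y ∘ₗ J E y) x := by
  refine smoothFormAt_of_apply fun c ↦ ?_
  have hx := mem_chart_source E x
  exact hη.apply (smoothVFAt_coordSymmAt hx c).J

lemma SmoothFormAt.add (hη : SmoothFormAt η x) (hζ : SmoothFormAt ζ x) :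
    SmoothFormAt (fun y ↦ η y + ζ y) x :=
  smoothFormAt_of_apply fun c ↦
    (hη.apply (smoothVFAt_coordSymmAt (mem_chart_source E x) c)).add
      (hζ.apply (smoothVFAt_coordSymmAt (mem_chart_source E x) c))

lemma SmoothFormAt.sub (hη : SmoothFormAt η x) (hζ : SmoothFormAt ζ x) :
    SmoothFormAt (fun y ↦ η y - ζ y) x :=
  smoothFormAt_of_apply fun c ↦
    (hη.apply (smoothVFAt_coordSymmAt (mem_chart_source E x) c)).sub
      (hζ.apply (smoothVFAt_coordSymmAt (mem_chart_source E x) c))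

lemma contMDiffAt_const_mul {f : X → ℂ} (c : ℂ) (hf : ContMDiffAt 𝓘(ℝ, E) 𝓘(ℝ, ℂ) ∞ f x) :
    ContMDiffAt 𝓘(ℝ, E) 𝓘(ℝ, ℂ) ∞ (fun y ↦ c * f y) x := by
  have h : ContMDiff 𝓘(ℝ, ℂ) 𝓘(ℝ, ℂ) ∞ (fun z : ℂ ↦ c * z) :=
    (contDiff_const.mul contDiff_id).contMDiff
  exact h.contMDiffAt.comp x hf

lemma SmoothFormAt.const_smul (c : ℂ) (hη : SmoothFormAt η x) :
    SmoothFormAt (fun y ↦ c • η y) x :=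
  smoothFormAt_of_apply fun e ↦
    contMDiffAt_const_mul c (hη.apply (smoothVFAt_coordSymmAt (mem_chart_source E x) e))

/-- Smoothness at a point of a complex vector field. -/
structure SmoothTCAt (V : Π x : X, TC E x) (x : X) : Prop where
  re : SmoothVFAt (fun y ↦ rePart (V y)) x
  im : SmoothVFAt (fun y ↦ imPart (V y)) x

variable {A B : Π x : X, TC E x}

lemma SmoothTCAt.add (hA : SmoothTCAt A x) (hB : SmoothTCAt B x) :
    SmoothTCAt (fun y ↦ A y + B y) x :=
  ⟨by simpa only [map_add] using hA.re.add hB.re, by simpa only [map_add] using hA.im.add hB.im⟩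

lemma SmoothTCAt.sub (hA : SmoothTCAt A x) (hB : SmoothTCAt B x) :
    SmoothTCAt (fun y ↦ A y - B y) x :=
  ⟨by simpa only [map_sub] using hA.re.sub hB.re, by simpa only [map_sub] using hA.im.sub hB.im⟩

lemma SmoothTCAt.const_smul (c : ℂ) (hA : SmoothTCAt A x) : SmoothTCAt (fun y ↦ c • A y) x :=
  ⟨by simpa only [rePart_smul] using (hA.re.const_smul c.re).sub (hA.im.const_smul c.im),
    by simpa only [imPart_smul] using (hA.im.const_smul c.re).add (hA.re.const_smul c.im)⟩

lemma SmoothTCAt.JC (hA : SmoothTCAt A x) : SmoothTCAt (fun y ↦ JC E y (A y)) x :=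
  ⟨by simpa only [rePart_JC] using hA.re.J, by simpa only [imPart_JC] using hA.im.J⟩

lemma SmoothTCAt.lieBracketC (hA : SmoothTCAt A x) (hB : SmoothTCAt B x) :
    SmoothTCAt (lieBracketC A B) x := by
  constructor
  · simp only [ExtendedPoisson.lieBracketC, rePart_ofReIm]
    exact (smoothVFAt_mlieBracket hA.re hB.re).sub (smoothVFAt_mlieBracket hA.im hB.im)
  · simp only [ExtendedPoisson.lieBracketC, imPart_ofReIm]
    exact (smoothVFAt_mlieBracket hA.re hB.im).add (smoothVFAt_mlieBracket hA.im hB.re)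

lemma smoothFormAt_lieDerivC (hA : ∀ x, SmoothTCAt A x) (hη : ∀ x, SmoothFormAt η x) (x : X) :
    SmoothFormAt (lieDerivC A η) x :=
  (smoothFormAt_lieDerivReal (fun x ↦ (hA x).re) hη x).add
    ((smoothFormAt_lieDerivReal (fun x ↦ (hA x).im) hη x).const_smul Complex.I)

lemma SmoothFormAt.evalC (hη : SmoothFormAt η x) (hA : SmoothTCAt A x) :
    ContMDiffAt 𝓘(ℝ, E) 𝓘(ℝ, ℂ) ∞ (fun y ↦ evalC E y (η y) (A y)) x := by
  simp only [evalC_eq]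
  exact (hη.apply hA.re).add (contMDiffAt_const_mul _ (hη.apply hA.im))

lemma smoothAlong_id_iff {τ : Π x : X, TC E x × CotC E x} :
    SmoothAlong E id τ ↔
      (∀ x, SmoothTCAt (fun y ↦ (τ y).1) x) ∧ ∀ x, SmoothFormAt (fun y ↦ (τ y).2) x :=
  ⟨fun h ↦ ⟨fun x ↦ ⟨h.re x, h.im x⟩, fun x ↦ h.form x⟩,
    fun h ↦ ⟨fun x ↦ (h.1 x).re, fun x ↦ (h.1 x).im, fun x ↦ h.2 x⟩⟩

lemma isSectionAstar_iff {α : Π x : X, Astar E x} :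
    IsSectionAstar α ↔ (∀ x, SmoothTCAt (fun y ↦ (α y).1.1) x) ∧
      ∀ x, SmoothFormAt (fun y ↦ (α y).1.2) x := smoothAlong_id_iff

lemma isSectionA_iff {u : Π x : X, ExtendedPoisson.A E x} :
    IsSectionA u ↔ (∀ x, SmoothTCAt (fun y ↦ (u y).1.1) x) ∧
      ∀ x, SmoothFormAt (fun y ↦ (u y).1.2) x := smoothAlong_id_iff

lemma isSectionAstar_projAstar (hA : ∀ x, SmoothTCAt A x) (hη : ∀ x, SmoothFormAt η x) :
    IsSectionAstar (fun x ↦ projAstar x (A x, η x)) :=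
  isSectionAstar_iff.2
    ⟨fun x ↦ ((hA x).add ((hA x).JC.const_smul Complex.I)).const_smul _,
      fun x ↦ ((hη x).sub ((hη x).comp_J.const_smul Complex.I)).const_smul _⟩

variable {α β : Π x : X, Astar E x} {u : Π x : X, ExtendedPoisson.A E x}

lemma IsSectionAstar.add (hα : IsSectionAstar α) (hβ : IsSectionAstar β) :
    IsSectionAstar (fun x ↦ α x + β x) := by
  rw [isSectionAstar_iff] at *
  exact ⟨fun x ↦ (hα.1 x).add (hβ.1 x), fun x ↦ (hα.2 x).add (hβ.2 x)⟩

lemma IsSectionAstar.sub (hα : IsSectionAstar α) (hβ : IsSectionAstar β) :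
    IsSectionAstar (fun x ↦ α x - β x) := by
  rw [isSectionAstar_iff] at *
  exact ⟨fun x ↦ (hα.1 x).sub (hβ.1 x), fun x ↦ (hα.2 x).sub (hβ.2 x)⟩

lemma isSectionAstar_bracketAstar (hα : IsSectionAstar α) (hβ : IsSectionAstar β) :
    IsSectionAstar (bracketAstar α β) := by
  rw [isSectionAstar_iff] at hα hβ
  exact isSectionAstar_projAstar (fun x ↦ (hα.1 x).lieBracketC (hβ.1 x))
    fun x ↦ (smoothFormAt_lieDerivC hα.1 hβ.2 x).sub (smoothFormAt_lieDerivC hβ.1 hα.2 x)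

lemma isSectionAstar_lieDerivAstar (hu : IsSectionA u) (hβ : IsSectionAstar β) :
    IsSectionAstar (lieDerivAstar u β) := by
  rw [isSectionA_iff] at hu
  rw [isSectionAstar_iff] at hβ
  exact isSectionAstar_projAstar (fun x ↦ (hu.1 x).lieBracketC (hβ.1 x))
    fun x ↦ (smoothFormAt_lieDerivC hu.1 hβ.2 x).sub
      ((smoothFormAt_lieDerivC hβ.1 hu.2 x).sub (smoothFormAt_dC ((hu.2 x).evalC (hβ.1 x))))

lemma contMDiffAt_pairing (hu : IsSectionA u) (hβ : IsSectionAstar β) (x : X) :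
    ContMDiffAt 𝓘(ℝ, E) 𝓘(ℝ, ℂ) ∞ (fun y ↦ pairing E y (u y) (β y)) x := by
  rw [isSectionA_iff] at hu
  rw [isSectionAstar_iff] at hβ
  exact ((hβ.2 x).evalC (hu.1 x)).add ((hu.2 x).evalC (hβ.1 x))

lemma smoothTCAt_zero (x : X) : SmoothTCAt (fun y : X ↦ (0 : TC E y)) x := by
  constructor <;>
  · simp only [map_zero]
    rw [smoothVFAt_iff]
    simpa only [map_zero] using contMDiffAt_const

lemma isSectionAstar_dFun {f : X → ℂ} (hf : ∀ x, ContMDiffAt 𝓘(ℝ, E) 𝓘(ℝ, ℂ) ∞ f x) :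
    IsSectionAstar (dFun (E := E) f) :=
  isSectionAstar_projAstar smoothTCAt_zero fun x ↦ smoothFormAt_dC (hf x)

lemma ExtendedPoissonStructure.isSectionAstar_bracket (P : ExtendedPoissonStructure E X)
    (hα : IsSectionAstar α) (hβ : IsSectionAstar β) : IsSectionAstar (P.bracket α β) :=
  (isSectionAstar_bracketAstar hα hβ).add
    (((isSectionAstar_lieDerivAstar (P.smooth α hα) hβ).sub
      (isSectionAstar_lieDerivAstar (P.smooth β hβ) hα)).sub
        (isSectionAstar_dFun (contMDiffAt_pairing (P.smooth α hα) hβ)))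

end Smoothness

/-! ### Slice charts: defining functions and tangent extensions -/

section Immersion

variable {E : Type*} [NormedAddCommGroup E] [NormedSpace ℂ E]
  {X : Type*} [TopologicalSpace X] [ChartedSpace E X]

lemma contMDiffAt_real_of_mem_maximalAtlas {e : OpenPartialHomeomorph X E}
    (he : e ∈ IsManifold.maximalAtlas 𝓘(ℂ, E) ω X) {x : X} (hx : x ∈ e.source) :
    ContMDiffAt 𝓘(ℝ, E) 𝓘(ℝ, E) ∞ e x :=
  (ContMDiffAt.restrictScalars_real (contMDiffAt_of_mem_maximalAtlas he hx)).of_le le_top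

lemma contMDiffAt_real_symm_of_mem_maximalAtlas {e : OpenPartialHomeomorph X E}
    (he : e ∈ IsManifold.maximalAtlas 𝓘(ℂ, E) ω X) {x : E} (hx : x ∈ e.target) :
    ContMDiffAt 𝓘(ℝ, E) 𝓘(ℝ, E) ∞ e.symm x :=
  (ContMDiffAt.restrictScalars_real (contMDiffAt_symm_of_mem_maximalAtlas he hx)).of_le le_top

lemma mdifferentiable_real_of_mem_maximalAtlas {e : OpenPartialHomeomorph X E}
    (he : e ∈ IsManifold.maximalAtlas 𝓘(ℂ, E) ω X) : e.MDifferentiable 𝓘(ℝ, E) 𝓘(ℝ, E) :=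
  ⟨fun _ hx ↦ ((contMDiffAt_real_of_mem_maximalAtlas he hx).mdifferentiableAt
      (by simp)).mdifferentiableWithinAt,
    fun _ hx ↦ ((contMDiffAt_real_symm_of_mem_maximalAtlas he hx).mdifferentiableAt
      (by simp)).mdifferentiableWithinAt⟩

variable [IsManifold 𝓘(ℂ, E) ω X]
  {F : Type*} [NormedAddCommGroup F] [NormedSpace ℂ F]
  {Y : Type*} [TopologicalSpace Y] [ChartedSpace F Y] [IsManifold 𝓘(ℂ, F) ω Y]
  {ι : Y → X} {y₀ : Y}

/-- The local normal form of an immersion, with the submanifold as the slice `F × 0`. -/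
lemma IsImmersionAt.codChart_apply (h : Manifold.IsImmersionAt 𝓘(ℂ, F) 𝓘(ℂ, E) ω ι y₀)
    {y : Y} (hy : y ∈ h.domChart.source) :
    h.codChart (ι y) = h.equiv (h.domChart y, 0) := by
  have hy' : h.domChart y ∈ (h.domChart.extend 𝓘(ℂ, F)).target := by
    simpa using h.domChart.map_source hy
  simpa [h.domChart.left_inv hy] using h.writtenInCharts hy'

lemma IsImmersionAt.mvfderiv_codChart (h : Manifold.IsImmersionAt 𝓘(ℂ, F) 𝓘(ℂ, E) ω ι y₀)
    (hι : ContMDiff 𝓘(ℂ, F) 𝓘(ℂ, E) ω ι)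
    {y : Y} (hy : y ∈ h.domChart.source) (w : TangentSpace 𝓘(ℝ, F) y) :
    mvfderiv 𝓘(ℝ, E) h.codChart (ι y) (mfderiv 𝓘(ℝ, F) 𝓘(ℝ, E) ι y w) =
      h.equiv (mvfderiv 𝓘(ℝ, F) h.domChart y w, 0) := by
  have h1 := (contMDiffAt_real_of_mem_maximalAtlas h.codChart_mem_maximalAtlas
    (h.source_subset_preimage_source hy)).mdifferentiableAt (n := ∞) (by simp)
  have h2 : MDifferentiableAt 𝓘(ℝ, F) 𝓘(ℝ, E) ι y :=
    (ContMDiffAt.restrictScalars_real (hι y)).mdifferentiableAt (by simp)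
  have h3 := (contMDiffAt_real_of_mem_maximalAtlas h.domChart_mem_maximalAtlas
    hy).mdifferentiableAt (n := ∞) (by simp)
  let L : F →L[ℝ] E := ((h.equiv : (F × h.complement) →L[ℂ] E).comp
    (ContinuousLinearMap.inl ℂ F h.complement)).restrictScalars ℝ
  have h4 : h.codChart ∘ ι =ᶠ[nhds y] L ∘ h.domChart := by
    filter_upwards [h.domChart.open_source.mem_nhds hy] with z hz
    exact IsImmersionAt.codChart_apply h hz
  have h5 := DFunLike.congr_fun (h4.mfderiv_eq (I := 𝓘(ℝ, F)) (I' := 𝓘(ℝ, E))) w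
  have hL : MDifferentiableAt 𝓘(ℝ, F) 𝓘(ℝ, E) L (h.domChart y) := L.mdifferentiableAt
  rw [mfderiv_comp y h1 h2, mfderiv_comp y hL h3] at h5
  have h6 : mfderiv 𝓘(ℝ, F) 𝓘(ℝ, E) L (h.domChart y) = L := L.mfderiv_eq
  rw [h6] at h5
  exact h5

/-- Locally, an immersed submanifold is cut out by a smooth function whose differential has the
tangent space as its kernel. -/
lemma IsImmersionAt.exists_definingFunction
    (h : Manifold.IsImmersionAt 𝓘(ℂ, F) 𝓘(ℂ, E) ω ι y₀)
    (hι : ContMDiff 𝓘(ℂ, F) 𝓘(ℂ, E) ω ι) :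
    ∃ f : X → E, ContMDiffAt 𝓘(ℝ, E) 𝓘(ℝ, E) ∞ f (ι y₀) ∧
      (∀ᶠ y in nhds y₀, f (ι y) = 0) ∧
      ∀ v, mvfderiv 𝓘(ℝ, E) f (ι y₀) v = 0 →
        v ∈ LinearMap.range (mfderiv 𝓘(ℝ, F) 𝓘(ℝ, E) ι y₀).toLinearMap := by
  let e := h.codChart
  -- The defining function is the transverse component of the slice chart. It is put back into `E`
  -- by `h.equiv`, so that its values lie in the model space.
  let pr : F × h.complement →L[ℂ] F × h.complement :=
    (ContinuousLinearMap.inr ℂ F h.complement).comp (ContinuousLinearMap.snd ℂ F h.complement)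
  let L : E →L[ℝ] E := ((h.equiv : (F × h.complement) →L[ℂ] E).comp
    (pr.comp (h.equiv.symm : E →L[ℂ] (F × h.complement)))).restrictScalars ℝ
  have he := contMDiffAt_real_of_mem_maximalAtlas h.codChart_mem_maximalAtlas h.mem_codChart_source
  refine ⟨L ∘ e, L.contDiff.contMDiff.contMDiffAt.comp _ he, ?_, ?_⟩
  · filter_upwards [h.domChart.open_source.mem_nhds h.mem_domChart_source] with y hy
    simp [L, e, pr, IsImmersionAt.codChart_apply h hy]
  · intro v hv
    have h1 : mvfderiv 𝓘(ℝ, E) (L ∘ e) (ι y₀) v = L (mvfderiv 𝓘(ℝ, E) e (ι y₀) v) := by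
      have h6 : mfderiv 𝓘(ℝ, E) 𝓘(ℝ, E) L (e (ι y₀)) = L := L.mfderiv_eq
      refine (mfderiv_comp_apply (ι y₀) L.mdifferentiableAt
        (he.mdifferentiableAt (by simp)) v).trans ?_
      rw [h6]
      rfl
    rw [h1] at hv
    -- With no transverse component, `v` has the same slice coordinates as the image of a tangent
    -- vector `w` of `Y`; the slice chart has an injective differential.
    have h2 : (h.equiv.symm (mvfderiv 𝓘(ℝ, E) e (ι y₀) v)).2 = 0 := by
      simpa [L, pr] using hv
    obtain ⟨w, hw⟩ := (mdifferentiable_real_of_mem_maximalAtlas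
      h.domChart_mem_maximalAtlas).mfderiv_surjective h.mem_domChart_source
        (h.equiv.symm (mvfderiv 𝓘(ℝ, E) e (ι y₀) v)).1
    refine ⟨w, ?_⟩
    refine (mdifferentiable_real_of_mem_maximalAtlas
      h.codChart_mem_maximalAtlas).mfderiv_injective h.mem_codChart_source ?_
    refine (IsImmersionAt.mvfderiv_codChart h hι h.mem_domChart_source w).trans ?_
    have h3 : mvfderiv 𝓘(ℝ, F) h.domChart y₀ w =
      (h.equiv.symm (mvfderiv 𝓘(ℝ, E) e (ι y₀) v)).1 := hw
    rw [h3, ← h2]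
    exact h.equiv.apply_symm_apply _

/-- Every tangent vector of an immersed submanifold extends locally to a smooth vector field that
is tangent to the submanifold. -/
lemma IsImmersionAt.exists_tangentExtension [CompleteSpace E]
    (h : Manifold.IsImmersionAt 𝓘(ℂ, F) 𝓘(ℂ, E) ω ι y₀)
    (hι : ContMDiff 𝓘(ℂ, F) 𝓘(ℂ, E) ω ι) (z : TangentSpace 𝓘(ℝ, F) y₀) :
    ∃ Z : Π x : X, TangentSpace 𝓘(ℝ, E) x, SmoothVFAt Z (ι y₀) ∧
      Z (ι y₀) = mfderiv 𝓘(ℝ, F) 𝓘(ℝ, E) ι y₀ z ∧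
      ∀ᶠ y in nhds y₀, Z (ι y) ∈ LinearMap.range (mfderiv 𝓘(ℝ, F) 𝓘(ℝ, E) ι y).toLinearMap := by
  let e := h.codChart
  let c : F := mvfderiv 𝓘(ℝ, F) h.domChart y₀ z
  -- A constant field along the slice: its pullback by the slice chart is tangent to `Y` at all
  -- nearby points of `Y`.
  let k : Π x : E, TangentSpace 𝓘(ℝ, E) x := fun _ ↦ h.equiv (c, 0)
  have he : ∀ {x : X}, x ∈ e.source → (mfderiv 𝓘(ℝ, E) 𝓘(ℝ, E) e x).IsInvertible := by
    intro x hx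
    have hd := mdifferentiable_real_of_mem_maximalAtlas h.codChart_mem_maximalAtlas
    have h1 := hd.symm_comp_deriv hx
    have h2 := hd.comp_symm_deriv (e.map_source hx)
    rw [e.left_inv hx] at h2
    exact ContinuousLinearMap.IsInvertible.of_inverse h2 h1
  have key : ∀ {y : Y}, y ∈ h.domChart.source → ∀ w : TangentSpace 𝓘(ℝ, F) y,
      mvfderiv 𝓘(ℝ, F) h.domChart y w = c →
      mpullback 𝓘(ℝ, E) 𝓘(ℝ, E) e k (ι y) = mfderiv 𝓘(ℝ, F) 𝓘(ℝ, E) ι y w := by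
    intro y hy w hw
    have h1 := IsImmersionAt.mvfderiv_codChart h hι hy w
    rw [hw] at h1
    have hinv := he (h.source_subset_preimage_source hy)
    rw [mpullback_apply]
    refine Eq.trans ?_ (hinv.inverse_apply_self (mfderiv 𝓘(ℝ, F) 𝓘(ℝ, E) ι y w))
    exact congrArg _ h1.symm
  refine ⟨mpullback 𝓘(ℝ, E) 𝓘(ℝ, E) e k, ?_, key h.mem_domChart_source z rfl, ?_⟩
  · refine ContMDiffAt.mpullback_vectorField_preimage (n := ∞) ?_
      (contMDiffAt_real_of_mem_maximalAtlas h.codChart_mem_maximalAtlas h.mem_codChart_source)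
      (he h.mem_codChart_source) le_rfl
    exact contMDiffAt_vectorSpace_iff_contDiffAt.2 contDiffAt_const
  · filter_upwards [h.domChart.open_source.mem_nhds h.mem_domChart_source] with y hy
    obtain ⟨w, hw⟩ := (mdifferentiable_real_of_mem_maximalAtlas
      h.domChart_mem_maximalAtlas).mfderiv_surjective hy c
    exact ⟨w, (key hy w hw).symm⟩

end Immersion

/-! ### Real vector fields tangent to a submanifold -/

section Tangency

variable {E : Type*} [NormedAddCommGroup E] [NormedSpace ℂ E] [FiniteDimensional ℂ E]
  {X : Type*} [TopologicalSpace X] [ChartedSpace E X] [IsManifold 𝓘(ℂ, E) ω X]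

section Pointwise

variable {V W W' : Π x : X, TangentSpace 𝓘(ℝ, E) x} {η : Π x : X, CotC E x} {x : X}

lemma exists_smoothVFAt_eq (v : TangentSpace 𝓘(ℝ, E) x) :
    ∃ Z : Π x : X, TangentSpace 𝓘(ℝ, E) x, SmoothVFAt Z x ∧ Z x = v :=
  ⟨fun y ↦ coordSymmAt x y (coordAt x x v), smoothVFAt_coordSymmAt (mem_chart_source E x) _,
    coordSymmAt_coordAt (mem_chart_source E x) v⟩

/-- `L_W η - d(η(W))` is the contraction `ι_W dη`, which depends on `W` only through its value. -/
lemma lieDerivReal_sub_mvfderiv_congr (hW : SmoothVFAt W x) (hW' : SmoothVFAt W' x)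
    (hη : SmoothFormAt η x) (h : W x = W' x) (v : TangentSpace 𝓘(ℝ, E) x) :
    lieDerivReal W η x v - mvfderiv 𝓘(ℝ, E) (fun y ↦ η y (W y)) x v =
      lieDerivReal W' η x v - mvfderiv 𝓘(ℝ, E) (fun y ↦ η y (W' y)) x v := by
  obtain ⟨Z, hZ, rfl⟩ := exists_smoothVFAt_eq v
  -- Antisymmetry of `dη`: exchanging `W` with an extension `Z` of `v` moves all derivatives from
  -- `W` to `Z`, and the right hand side contains only `W x`.
  have key : ∀ {W : Π x : X, TangentSpace 𝓘(ℝ, E) x}, SmoothVFAt W x →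
      lieDerivReal W η x (Z x) - mvfderiv 𝓘(ℝ, E) (fun y ↦ η y (W y)) x (Z x) =
        mvfderiv 𝓘(ℝ, E) (fun y ↦ η y (Z y)) x (W x) - lieDerivReal Z η x (W x) := by
    intro W hW
    rw [lieDerivReal_apply hW hη hZ, lieDerivReal_apply hZ hη hW, mlieBracket_swap_apply, map_neg]
    ring
  rw [key hW, key hW', h]

end Pointwise

variable {F : Type*} [NormedAddCommGroup F] [NormedSpace ℂ F]
  {Y : Type*} [TopologicalSpace Y] [ChartedSpace F Y] [IsManifold 𝓘(ℂ, F) ω Y]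
  {ι : Y → X}

variable (E F) in
/-- The real tangent space of an immersed submanifold. -/
abbrev tangentRange (ι : Y → X) (y : Y) : Submodule ℝ (TangentSpace 𝓘(ℝ, E) (ι y)) :=
  LinearMap.range (mfderiv 𝓘(ℝ, F) 𝓘(ℝ, E) ι y).toLinearMap

/-- The derivatives of two functions along a tangent vector of a submanifold coincide if the
functions coincide on the submanifold. -/
lemma mvfderiv_congr_of_comp {G : Type*} [NormedAddCommGroup G] [NormedSpace ℝ G] {f g : X → G}
    {y : Y} (hι : MDifferentiableAt 𝓘(ℝ, F) 𝓘(ℝ, E) ι y)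
    (hf : MDifferentiableAt 𝓘(ℝ, E) 𝓘(ℝ, G) f (ι y))
    (hg : MDifferentiableAt 𝓘(ℝ, E) 𝓘(ℝ, G) g (ι y))
    (h : ∀ᶠ z in nhds y, f (ι z) = g (ι z)) {v : TangentSpace 𝓘(ℝ, E) (ι y)}
    (hv : v ∈ tangentRange E F ι y) :
    mvfderiv 𝓘(ℝ, E) f (ι y) v = mvfderiv 𝓘(ℝ, E) g (ι y) v := by
  obtain ⟨w, rfl⟩ := hv
  have h1 : f ∘ ι =ᶠ[nhds y] g ∘ ι := h
  have h2 := DFunLike.congr_fun (h1.mfderiv_eq (I := 𝓘(ℝ, F)) (I' := 𝓘(ℝ, G))) w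
  rw [mfderiv_comp y hf hι, mfderiv_comp y hg hι] at h2
  exact h2

lemma mvfderiv_eq_zero_of_comp {G : Type*} [NormedAddCommGroup G] [NormedSpace ℝ G] {f : X → G}
    {y : Y} (hι : MDifferentiableAt 𝓘(ℝ, F) 𝓘(ℝ, E) ι y)
    (hf : MDifferentiableAt 𝓘(ℝ, E) 𝓘(ℝ, G) f (ι y))
    (h : ∀ᶠ z in nhds y, f (ι z) = 0) {v : TangentSpace 𝓘(ℝ, E) (ι y)}
    (hv : v ∈ tangentRange E F ι y) :
    mvfderiv 𝓘(ℝ, E) f (ι y) v = 0 := by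
  rw [mvfderiv_congr_of_comp (g := fun _ ↦ 0) hι hf mdifferentiableAt_const h hv]
  simp [mvfderiv_const]

variable {V W W' : Π x : X, TangentSpace 𝓘(ℝ, E) x} {η ζ : Π x : X, CotC E x} {y₀ : Y}

/-- The Lie bracket of vector fields that are tangent to a submanifold is tangent to it. -/
lemma mlieBracket_mem_tangentRange (hι : Manifold.IsSmoothEmbedding 𝓘(ℂ, F) 𝓘(ℂ, E) ω ι)
    (hV : SmoothVFAt V (ι y₀)) (hW : SmoothVFAt W (ι y₀))
    (hVt : ∀ᶠ y in nhds y₀, V (ι y) ∈ tangentRange E F ι y)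
    (hWt : ∀ᶠ y in nhds y₀, W (ι y) ∈ tangentRange E F ι y) :
    mlieBracket 𝓘(ℝ, E) V W (ι y₀) ∈ tangentRange E F ι y₀ := by
  have : CompleteSpace E := FiniteDimensional.complete ℂ E
  have hd : ∀ y, MDifferentiableAt 𝓘(ℝ, F) 𝓘(ℝ, E) ι y := fun y ↦
    (ContMDiffAt.restrictScalars_real (hι.contMDiff y)).mdifferentiableAt (by simp)
  obtain ⟨f, hf, hf0, hfker⟩ :=
    IsImmersionAt.exists_definingFunction (hι.isImmersion.isImmersionAt y₀) hι.contMDiff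
  refine hfker _ ?_
  have hfd : ∀ᶠ y in nhds y₀, MDifferentiableAt 𝓘(ℝ, E) 𝓘(ℝ, E) f (ι y) := by
    have h1 : ContMDiffAt 𝓘(ℝ, E) 𝓘(ℝ, E) 1 f (ι y₀) := hf.of_le (by simp)
    have h2 := (contMDiffAt_iff_contMDiffAt_nhds (by simp)).1 h1
    exact (hι.contMDiff.continuous.continuousAt.eventually h2).mono
      fun y hy ↦ hy.mdifferentiableAt (by simp)
  -- For tangent `V` the function `V f` vanishes on `Y` near `y₀`. Hence `V(W f) - W(V f)` vanishes
  -- at `ι y₀`, and `[V, W]` lies in the kernel of `df`.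
  have key : ∀ {V : Π x : X, TangentSpace 𝓘(ℝ, E) x},
      (∀ᶠ y in nhds y₀, V (ι y) ∈ tangentRange E F ι y) →
      ∀ᶠ y in nhds y₀, mvfderiv 𝓘(ℝ, E) f (ι y) (V (ι y)) = 0 := by
    intro V hVt
    filter_upwards [hVt, hfd, hf0.eventually_nhds] with y h1 h2 h3
    exact mvfderiv_eq_zero_of_comp (hd y) h2 h3 h1
  rw [mvfderiv_mlieBracket hf hV hW,
    mvfderiv_eq_zero_of_comp (hd y₀) ((hW.mvfderiv hf).mdifferentiableAt (by simp)) (key hWt)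
      hVt.self_of_nhds,
    mvfderiv_eq_zero_of_comp (hd y₀) ((hV.mvfderiv hf).mdifferentiableAt (by simp)) (key hVt)
      hWt.self_of_nhds, sub_zero]

/-- The Lie bracket with a vector field that is tangent to a submanifold only depends on the
restriction to the submanifold. -/
lemma mlieBracket_congr_of_tangent (hι : MDifferentiableAt 𝓘(ℝ, F) 𝓘(ℝ, E) ι y₀)
    (hV : SmoothVFAt V (ι y₀)) (hW : SmoothVFAt W (ι y₀)) (hW' : SmoothVFAt W' (ι y₀))
    (hVt : V (ι y₀) ∈ tangentRange E F ι y₀) (h : ∀ y, W (ι y) = W' (ι y)) :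
    mlieBracket 𝓘(ℝ, E) V W (ι y₀) = mlieBracket 𝓘(ℝ, E) V W' (ι y₀) := by
  have hx := mem_chart_source E (ι y₀)
  -- In coordinates `[V, W] = D_V W - D_W V`: the first term differentiates `W` in a tangent
  -- direction, the second sees only the value of `W` at the point.
  rw [← coordSymmAt_coordAt hx (mlieBracket 𝓘(ℝ, E) V W (ι y₀)), coordAt_mlieBracket_eq hV hW,
    h y₀, mvfderiv_congr_of_comp hι ((smoothVFAt_iff.1 hW).mdifferentiableAt (by simp))
      ((smoothVFAt_iff.1 hW').mdifferentiableAt (by simp))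
      (Filter.Eventually.of_forall fun y ↦ by rw [h y]) hVt,
    ← coordAt_mlieBracket_eq hV hW', coordSymmAt_coordAt hx]

/-- The Lie derivative along a vector field that is tangent to a submanifold preserves the
one-forms that annihilate its tangent vectors. -/
lemma lieDerivReal_eq_zero_of_tangent (hι : Manifold.IsSmoothEmbedding 𝓘(ℂ, F) 𝓘(ℂ, E) ω ι)
    (hV : SmoothVFAt V (ι y₀)) (hη : SmoothFormAt η (ι y₀))
    (hVt : ∀ y, V (ι y) ∈ tangentRange E F ι y)
    (hη0 : ∀ y, ∀ v ∈ tangentRange E F ι y, η (ι y) v = 0)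
    {v : TangentSpace 𝓘(ℝ, E) (ι y₀)} (hv : v ∈ tangentRange E F ι y₀) :
    lieDerivReal V η (ι y₀) v = 0 := by
  have : CompleteSpace E := FiniteDimensional.complete ℂ E
  obtain ⟨z, rfl⟩ := hv
  have hd : MDifferentiableAt 𝓘(ℝ, F) 𝓘(ℝ, E) ι y₀ :=
    (ContMDiffAt.restrictScalars_real (hι.contMDiff y₀)).mdifferentiableAt (by simp)
  -- An extension tangent to `Y` makes both terms of `V(η(Z)) - η([V, Z])` vanish: `η(Z)` is zero on
  -- `Y` near `y₀`, and `[V, Z]` is tangent at `ι y₀`.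
  obtain ⟨Z, hZ, hZ0, hZt⟩ :=
    IsImmersionAt.exists_tangentExtension (hι.isImmersion.isImmersionAt y₀) hι.contMDiff z
  have h1 := lieDerivReal_apply hV hη hZ
  rw [mvfderiv_eq_zero_of_comp hd ((hη.apply hZ).mdifferentiableAt (by simp))
      (hZt.mono fun y hy ↦ hη0 y _ hy) (hVt y₀),
    hη0 y₀ _ (mlieBracket_mem_tangentRange hι hV hZ (Filter.Eventually.of_forall hVt) hZt),
    sub_zero, hZ0] at h1
  exact h1

/-- The Lie derivative along a vector field that is tangent to a submanifold only depends on the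
restriction of the one-form. -/
lemma lieDerivReal_congr_of_tangent (hι : MDifferentiableAt 𝓘(ℝ, F) 𝓘(ℝ, E) ι y₀)
    (hV : SmoothVFAt V (ι y₀)) (hη : SmoothFormAt η (ι y₀)) (hζ : SmoothFormAt ζ (ι y₀))
    (hVt : V (ι y₀) ∈ tangentRange E F ι y₀) (h : ∀ y, η (ι y) = ζ (ι y)) :
    lieDerivReal V η (ι y₀) = lieDerivReal V ζ (ι y₀) := by
  ext v
  obtain ⟨Z, hZ, rfl⟩ := exists_smoothVFAt_eq v
  rw [lieDerivReal_apply hV hη hZ, lieDerivReal_apply hV hζ hZ, h y₀,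
    mvfderiv_congr_of_comp hι ((hη.apply hZ).mdifferentiableAt (by simp))
      ((hζ.apply hZ).mdifferentiableAt (by simp))
      (Filter.Eventually.of_forall fun y ↦ by rw [h y]) hVt]

end Tangency

/-! ### Skew-symmetry of `H♯` -/

section Linear

variable {A B : Type*} [AddCommGroup A] [Module ℂ A] [AddCommGroup B] [Module ℂ B]

/-- Both sides are linear in `H`, so decomposable bivectors `u ∧ v` suffice, where the formula is
explicit. -/
lemma contraction_skew (p : A →ₗ[ℂ] B →ₗ[ℂ] ℂ) (H : ⋀[ℂ]^2 A) (α β : B) :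
    p (contraction p H α) β = -p (contraction p H β) α := by
  let L : B → B → (⋀[ℂ]^2 A) →ₗ[ℂ] ℂ := fun α β ↦
    (p.flip β) ∘ₗ (LinearMap.applyₗ α) ∘ₗ (contraction p)
  have h : L α β = -L β α := by
    apply exteriorPower.linearMap_ext
    ext m
    simp [L, contraction, contractionAlt]
    ring
  exact DFunLike.congr_fun h H

end Linear

/-! ### Algebraic rules for projections, brackets and differentials -/

section Complexified

variable {E : Type*} [NormedAddCommGroup E] [NormedSpace ℂ E]
  {X : Type*} [TopologicalSpace X] [ChartedSpace E X]

lemma pairing_sharp_skew (x : X) (H : ⋀[ℂ]^2 (A E x)) (α β : Astar E x) :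
    pairing E x (sharp x H α) β = -pairing E x (sharp x H β) α :=
  contraction_skew _ H α β

lemma projAstar_add (x : X) (τ σ : TC E x × CotC E x) :
    projAstar x (τ + σ) = projAstar x τ + projAstar x σ := by
  apply Subtype.ext
  apply Prod.ext
  · simp only [projAstar, Prod.fst_add, map_add, Submodule.coe_add]
    module
  · simp only [projAstar, Prod.snd_add, LinearMap.add_comp, Submodule.coe_add]
    module

lemma projAstar_neg (x : X) (τ : TC E x × CotC E x) : projAstar x (-τ) = -projAstar x τ := by
  rw [eq_neg_iff_add_eq_zero, ← projAstar_add, neg_add_cancel]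
  apply Subtype.ext
  apply Prod.ext <;> simp [projAstar]

lemma projAstar_sub (x : X) (τ σ : TC E x × CotC E x) :
    projAstar x (τ - σ) = projAstar x τ - projAstar x σ := by
  rw [sub_eq_add_neg, projAstar_add, projAstar_neg, sub_eq_add_neg]

lemma lieBracketC_swap (V W : Π x : X, TC E x) (x : X) :
    lieBracketC V W x = -lieBracketC W V x := by
  apply complexified_ext
  · simp only [lieBracketC, rePart_ofReIm, map_neg]
    rw [mlieBracket_swap_apply, mlieBracket_swap_apply (V := fun y ↦ imPart (V y))]
    abel
  · simp only [lieBracketC, imPart_ofReIm, map_neg]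
    rw [mlieBracket_swap_apply, mlieBracket_swap_apply (V := fun y ↦ imPart (V y))]
    abel

lemma dC_neg (f : X → ℂ) (x : X) : dC (E := E) (fun y ↦ -f y) x = -dC f x := by
  have h : mvfderiv 𝓘(ℝ, E) (fun y ↦ -f y) x = -mvfderiv 𝓘(ℝ, E) f x := mvfderiv_neg
  rw [dC, h]
  rfl

lemma dC_add {f g : X → ℂ} {x : X} (hf : MDifferentiableAt 𝓘(ℝ, E) 𝓘(ℝ, ℂ) f x)
    (hg : MDifferentiableAt 𝓘(ℝ, E) 𝓘(ℝ, ℂ) g x) :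
    dC (E := E) (fun y ↦ f y + g y) x = dC f x + dC g x := by
  have h : mvfderiv 𝓘(ℝ, E) (fun y ↦ f y + g y) x =
    mvfderiv 𝓘(ℝ, E) f x + mvfderiv 𝓘(ℝ, E) g x := mvfderiv_add hf hg
  rw [dC, h]
  rfl

lemma dC_const_mul {f : X → ℂ} {x : X} (c : ℂ) (hf : MDifferentiableAt 𝓘(ℝ, E) 𝓘(ℝ, ℂ) f x) :
    dC (E := E) (fun y ↦ c * f y) x = c • dC f x := by
  ext v
  let L : ℂ →L[ℝ] ℂ := (ContinuousLinearMap.mul ℝ ℂ) c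
  have h6 : mfderiv 𝓘(ℝ, ℂ) 𝓘(ℝ, ℂ) L (f x) = L := L.mfderiv_eq
  have h7 := mfderiv_comp_apply x (g := L) (L.mdifferentiableAt (x := f x)) hf v
  rw [h6] at h7
  exact h7

lemma projA_add_projAstar_fst (x : X) (t : TC E x) :
    (projA x (t, 0)).1.1 + (projAstar x (t, 0)).1.1 = t := by
  simp only [projA, projAstar]
  module

lemma evalC_inl (x : X) (η : CotC E x) (v : TangentSpace 𝓘(ℝ, E) x) :
    evalC E x η (ofReIm v 0) = η v := by
  rw [evalC_eq, rePart_ofReIm, imPart_ofReIm, map_zero, mul_zero, add_zero]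

end Complexified

/-! ### Pointwise description of `K` and of its annihilator -/

section Submanifold

variable {E : Type*} [NormedAddCommGroup E] [NormedSpace ℂ E]
  {X : Type*} [TopologicalSpace X] [ChartedSpace E X]
  {F : Type*} [NormedAddCommGroup F] [NormedSpace ℂ F]
  {Y : Type*} [TopologicalSpace Y] [ChartedSpace F Y] {ι : Y → X} {y : Y}

variable (E F) in
/-- The fibre at `y` of `T_ℂ Y ⊕ Ann(T_ℂ Y)`. -/
def tangentAnnihilator (ι : Y → X) (y : Y) : Submodule ℂ (TC E (ι y) × CotC E (ι y)) where
  carrier := {τ | τ.1 ∈ LinearMap.range (mfderivC E F ι y) ∧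
    ∀ v ∈ tangentRange E F ι y, τ.2 v = 0}
  add_mem' := fun ha hb ↦ ⟨add_mem ha.1 hb.1, fun v hv ↦ by simp [ha.2 v hv, hb.2 v hv]⟩
  zero_mem' := ⟨zero_mem _, fun v _ ↦ by simp⟩
  smul_mem' := fun c a ha ↦ ⟨Submodule.smul_mem _ c ha.1, fun v hv ↦ by simp [ha.2 v hv]⟩

lemma mem_range_mfderivC_iff (t : TC E (ι y)) :
    t ∈ LinearMap.range (mfderivC E F ι y) ↔
      rePart t ∈ tangentRange E F ι y ∧ imPart t ∈ tangentRange E F ι y :=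
  mem_range_baseChange_iff _ t

/-- Isotropy of `T_ℂ Y ⊕ Ann(T_ℂ Y)`. It makes the functions under the exact terms of the bracket
vanish along `Y`. -/
lemma evalC_eq_zero_of_mem {τ σ : TC E (ι y) × CotC E (ι y)}
    (hτ : τ ∈ tangentAnnihilator E F ι y) (hσ : σ ∈ tangentAnnihilator E F ι y) :
    evalC E (ι y) τ.2 σ.1 = 0 := by
  have h := (mem_range_mfderivC_iff _).1 hσ.1
  rw [evalC_eq, hτ.2 _ h.1, hτ.2 _ h.2, mul_zero, add_zero]

lemma mfderivC_mem_T10 (hι : MDifferentiableAt 𝓘(ℂ, F) 𝓘(ℂ, E) ι y) {t : TC F y}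
    (ht : t ∈ T10 F y) : mfderivC E F ι y t ∈ T10 E (ι y) := by
  refine Module.End.mem_eigenspace_iff.2 ?_
  rw [← mfderivC_JC hι, Module.End.mem_eigenspace_iff.1 ht, map_smul]

lemma mfderivC_mem_T01 (hι : MDifferentiableAt 𝓘(ℂ, F) 𝓘(ℂ, E) ι y) {t : TC F y}
    (ht : t ∈ T01 F y) : mfderivC E F ι y t ∈ T01 E (ι y) := by
  refine Module.End.mem_eigenspace_iff.2 ?_
  rw [← mfderivC_JC hι, Module.End.mem_eigenspace_iff.1 ht, map_smul]

/-- A covector annihilates the tangent vectors of a submanifold if it annihilates those of type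
`(1,0)` and those of type `(0,1)`. -/
lemma eq_zero_of_types {η : CotC E (ι y)}
    (h10 : ∀ t ∈ T10 F y, evalC E (ι y) η (mfderivC E F ι y t) = 0)
    (h01 : ∀ t ∈ T01 F y, evalC E (ι y) η (mfderivC E F ι y t) = 0)
    {v : TangentSpace 𝓘(ℝ, E) (ι y)} (hv : v ∈ tangentRange E F ι y) : η v = 0 := by
  obtain ⟨w, rfl⟩ := hv
  have h1 : mfderivC E F ι y (ofReIm w 0) = ofReIm (mfderiv 𝓘(ℝ, F) 𝓘(ℝ, E) ι y w) 0 := by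
    refine (baseChange_ofReIm _ w 0).trans ?_
    rw [map_zero]
    rfl
  have h2 := projA_add_projAstar_fst y (ofReIm w 0)
  have h3 := h10 _ (projA y (ofReIm w 0, 0)).2.1
  have h4 := h01 _ (projAstar y (ofReIm w 0, 0)).2.1
  rw [← evalC_inl]
  refine (congrArg _ h1.symm).trans ?_
  rw [← h2, map_add, map_add, h3, h4, add_zero]

/-- The type conditions are already part of `A*`. A covector of type `(1,0)` kills the `(0,1)`
vectors of `Y` for free. If the image of `t` has type `(0,1)`, the `(0,1)` part of `t` has the same
image, because the differential commutes with the complex structures. -/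
lemma mem_K_iff (hι : MDifferentiableAt 𝓘(ℂ, F) 𝓘(ℂ, E) ι y) (α : Astar E (ι y)) :
    α ∈ K E F ι y ↔ α.1 ∈ tangentAnnihilator E F ι y := by
  constructor
  · rintro ⟨⟨t, ht, hta⟩, h2⟩
    refine ⟨⟨t, hta⟩, fun v hv ↦ eq_zero_of_types h2 (fun t ht ↦ ?_) hv⟩
    exact α.2.2 _ (mfderivC_mem_T01 hι ht)
  · rintro ⟨⟨t, hta⟩, h2⟩
    refine ⟨⟨(projAstar y (t, 0)).1.1, (projAstar y (t, 0)).2.1, ?_⟩, fun v _ ↦ ?_⟩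
    · have h3 := Module.End.mem_eigenspace_iff.1 α.2.1
      simp only [projAstar, map_smul, map_add, mfderivC_JC hι, hta, h3, smul_smul]
      rw [mul_neg, Complex.I_mul_I]
      module
    · have h3 := (mem_range_mfderivC_iff _).1 (LinearMap.mem_range_self (mfderivC E F ι y) v)
      rw [evalC_eq, h2 _ h3.1, h2 _ h3.2, mul_zero, add_zero]

/-- The projection is built from the complex structure, which preserves the tangent space of `Y` and
hence its annihilator. -/
lemma projAstar_mem_K (hι : MDifferentiableAt 𝓘(ℂ, F) 𝓘(ℂ, E) ι y)
    {τ : TC E (ι y) × CotC E (ι y)} (hτ : τ ∈ tangentAnnihilator E F ι y) :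
    projAstar (ι y) τ ∈ K E F ι y := by
  rw [mem_K_iff hι]
  obtain ⟨⟨t, ht⟩, h2⟩ := hτ
  refine ⟨⟨(1 / 2 : ℂ) • (t + Complex.I • JC F y t), ?_⟩, ?_⟩
  · simp only [map_smul, map_add, mfderivC_JC hι, ht, projAstar]
  · rintro v ⟨w, rfl⟩
    have h3 := h2 _ ⟨w, rfl⟩
    have h4 : τ.2 (J E (ι y) (mfderiv 𝓘(ℝ, F) 𝓘(ℝ, E) ι y w)) = 0 := by
      rw [← mfderiv_J hι]
      exact h2 _ ⟨_, rfl⟩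
    simp only [projAstar, LinearMap.smul_apply, LinearMap.sub_apply, LinearMap.comp_apply]
    rw [h3]
    refine (congrArg (fun z : ℂ ↦ (1 / 2 : ℂ) • (0 - Complex.I • z)) h4).trans ?_
    simp

/-- The annihilator of `K` consists of vectors of type `(1,0)` tangent to the submanifold and of
covectors that annihilate its tangent vectors. -/
lemma mem_tangentAnnihilator_of_pairing (hι : MDifferentiableAt 𝓘(ℂ, F) 𝓘(ℂ, E) ι y)
    {u : A E (ι y)} (hu : ∀ β ∈ K E F ι y, pairing E (ι y) u β = 0) :
    u.1 ∈ tangentAnnihilator E F ι y := by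
  constructor
  -- If `u.1.1` were outside `S`, a functional vanishing on `S` but not on `u.1.1` would exist.
  -- Vanishing on `T^{0,1} X` gives it type `(1,0)`, vanishing on `T^{1,0} Y` puts it in `N^{1,0}
  -- Y`, so it contradicts `hu`.
  · let S := (T10 F y).map (mfderivC E F ι y) ⊔ T01 E (ι y)
    have hS : u.1.1 ∈ S := by
      by_contra hn
      obtain ⟨f, hf, hfS⟩ := Submodule.exists_le_ker_of_notMem hn
      have hev : evalC E (ι y) ((LinearMap.liftBaseChangeEquiv ℂ).symm f) = f :=
        (LinearMap.liftBaseChangeEquiv ℂ).apply_symm_apply f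
      let η : CotC E (ι y) := (LinearMap.liftBaseChangeEquiv ℂ).symm f
      have hη : η ∈ Cot10 E (ι y) := fun v hv ↦ by
        rw [hev]
        exact hfS (Submodule.mem_sup_right hv)
      have h1 := hu ⟨(0, η), zero_mem _, hη⟩ ⟨zero_mem _, fun v hv ↦ by
        rw [hev]
        exact hfS (Submodule.mem_sup_left ⟨v, hv, rfl⟩)⟩
      apply hf
      simpa [pairing, η, hev] using h1
    obtain ⟨_, ⟨t, ht, rfl⟩, w, hw, htw⟩ := Submodule.mem_sup.1 hS
    -- The remainder `w` has both types, hence vanishes.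
    have hw' : w ∈ T10 E (ι y) := by
      rw [← add_sub_cancel_left (mfderivC E F ι y t) w, htw]
      exact sub_mem u.2.1 (mfderivC_mem_T10 hι ht)
    have h1 := Module.End.mem_eigenspace_iff.1 hw
    rw [Module.End.mem_eigenspace_iff.1 hw', neg_smul, eq_neg_iff_add_eq_zero, ← two_smul ℂ] at h1
    have hw0 : w = 0 := by simpa using h1
    exact ⟨t, by rw [← htw, hw0, add_zero]⟩
  · intro v hv
    refine eq_zero_of_types (fun t ht ↦ u.2.2 _ (mfderivC_mem_T10 hι ht)) (fun t ht ↦ ?_) hv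
    have h1 := hu ⟨(mfderivC E F ι y t, 0), mfderivC_mem_T01 hι ht, zero_mem _⟩
      ⟨⟨t, ht, rfl⟩, fun v _ ↦ by simp⟩
    simpa [pairing] using h1

end Submanifold

/-! ### Complex-bilinear versions of the tangency statements -/

section TangentCalculus

variable {E : Type*} [NormedAddCommGroup E] [NormedSpace ℂ E] [FiniteDimensional ℂ E]
  {X : Type*} [TopologicalSpace X] [ChartedSpace E X] [IsManifold 𝓘(ℂ, E) ω X]
  {A A' B B' : Π x : X, TC E x} {η ζ : Π x : X, CotC E x}

/-- `L_A η - d(η(A))` is the contraction `ι_A dη`, which depends on `A` only through its value. -/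
lemma lieDerivC_sub_dC_congr {x : X} (hA : SmoothTCAt A x) (hA' : SmoothTCAt A' x)
    (hη : SmoothFormAt η x) (h : A x = A' x) :
    lieDerivC A η x - dC (fun y ↦ evalC E y (η y) (A y)) x =
      lieDerivC A' η x - dC (fun y ↦ evalC E y (η y) (A' y)) x := by
  have hd {V : Π x : X, TangentSpace 𝓘(ℝ, E) x} (hV : SmoothVFAt V x) :
      MDifferentiableAt 𝓘(ℝ, E) 𝓘(ℝ, ℂ) (fun y ↦ η y (V y)) x :=
    (hη.apply hV).mdifferentiableAt (by simp)
  have key {C : Π x : X, TC E x} (hC : SmoothTCAt C x) :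
      dC (E := E) (fun y ↦ evalC E y (η y) (C y)) x =
        dC (fun y ↦ η y (rePart (C y))) x + Complex.I • dC (fun y ↦ η y (imPart (C y))) x := by
    simp only [evalC_eq]
    rw [dC_add (hd hC.re)
      ((contMDiffAt_const_mul _ (hη.apply hC.im)).mdifferentiableAt (by simp)),
      dC_const_mul _ (hd hC.im)]
  rw [key hA, key hA']
  ext v
  have h1 := lieDerivReal_sub_mvfderiv_congr hA.re hA'.re hη (by rw [h]) v
  have h2 := lieDerivReal_sub_mvfderiv_congr hA.im hA'.im hη (by rw [h]) v
  simp only [lieDerivC, dC, LinearMap.sub_apply, LinearMap.add_apply, LinearMap.smul_apply,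
    ContinuousLinearMap.coe_coe, smul_eq_mul]
  linear_combination h1 + Complex.I * h2

variable {F : Type*} [NormedAddCommGroup F] [NormedSpace ℂ F]
  [FiniteDimensional ℂ F] {Y : Type*} [TopologicalSpace Y] [ChartedSpace F Y]
  [IsManifold 𝓘(ℂ, F) ω Y] {ι : Y → X} {y₀ : Y}

lemma lieBracketC_congr_of_tangent (hι : MDifferentiableAt 𝓘(ℝ, F) 𝓘(ℝ, E) ι y₀)
    (hA : SmoothTCAt A (ι y₀)) (hB : SmoothTCAt B (ι y₀)) (hB' : SmoothTCAt B' (ι y₀))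
    (hAt : A (ι y₀) ∈ LinearMap.range (mfderivC E F ι y₀)) (h : ∀ y, B (ι y) = B' (ι y)) :
    lieBracketC A B (ι y₀) = lieBracketC A B' (ι y₀) := by
  have ht := (mem_range_mfderivC_iff _).1 hAt
  have hr : ∀ y, rePart (B (ι y)) = rePart (B' (ι y)) := fun y ↦ by rw [h y]
  have hi : ∀ y, imPart (B (ι y)) = imPart (B' (ι y)) := fun y ↦ by rw [h y]
  simp only [lieBracketC]
  rw [mlieBracket_congr_of_tangent hι hA.re hB.re hB'.re ht.1 hr,
    mlieBracket_congr_of_tangent hι hA.im hB.im hB'.im ht.2 hi,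
    mlieBracket_congr_of_tangent hι hA.re hB.im hB'.im ht.1 hi,
    mlieBracket_congr_of_tangent hι hA.im hB.re hB'.re ht.2 hr]

lemma lieDerivC_congr_of_tangent (hι : MDifferentiableAt 𝓘(ℝ, F) 𝓘(ℝ, E) ι y₀)
    (hA : SmoothTCAt A (ι y₀)) (hη : SmoothFormAt η (ι y₀)) (hζ : SmoothFormAt ζ (ι y₀))
    (hAt : A (ι y₀) ∈ LinearMap.range (mfderivC E F ι y₀)) (h : ∀ y, η (ι y) = ζ (ι y)) :
    lieDerivC A η (ι y₀) = lieDerivC A ζ (ι y₀) := by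
  have ht := (mem_range_mfderivC_iff _).1 hAt
  rw [lieDerivC, lieDerivC, lieDerivReal_congr_of_tangent hι hA.re hη hζ ht.1 h,
    lieDerivReal_congr_of_tangent hι hA.im hη hζ ht.2 h]

lemma lieBracketC_mem_range (hι : Manifold.IsSmoothEmbedding 𝓘(ℂ, F) 𝓘(ℂ, E) ω ι)
    (hA : SmoothTCAt A (ι y₀)) (hB : SmoothTCAt B (ι y₀))
    (hAt : ∀ y, A (ι y) ∈ LinearMap.range (mfderivC E F ι y))
    (hBt : ∀ y, B (ι y) ∈ LinearMap.range (mfderivC E F ι y)) :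
    lieBracketC A B (ι y₀) ∈ LinearMap.range (mfderivC E F ι y₀) := by
  have hA1 := Filter.Eventually.of_forall (f := nhds y₀)
    fun y ↦ ((mem_range_mfderivC_iff _).1 (hAt y)).1
  have hA2 := Filter.Eventually.of_forall (f := nhds y₀)
    fun y ↦ ((mem_range_mfderivC_iff _).1 (hAt y)).2
  have hB1 := Filter.Eventually.of_forall (f := nhds y₀)
    fun y ↦ ((mem_range_mfderivC_iff _).1 (hBt y)).1
  have hB2 := Filter.Eventually.of_forall (f := nhds y₀)
    fun y ↦ ((mem_range_mfderivC_iff _).1 (hBt y)).2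
  rw [mem_range_mfderivC_iff, lieBracketC, rePart_ofReIm, imPart_ofReIm]
  exact ⟨sub_mem (mlieBracket_mem_tangentRange hι hA.re hB.re hA1 hB1)
      (mlieBracket_mem_tangentRange hι hA.im hB.im hA2 hB2),
    add_mem (mlieBracket_mem_tangentRange hι hA.re hB.im hA1 hB2)
      (mlieBracket_mem_tangentRange hι hA.im hB.re hA2 hB1)⟩

lemma lieDerivC_eq_zero_of_tangent (hι : Manifold.IsSmoothEmbedding 𝓘(ℂ, F) 𝓘(ℂ, E) ω ι)
    (hA : SmoothTCAt A (ι y₀)) (hη : SmoothFormAt η (ι y₀))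
    (hAt : ∀ y, A (ι y) ∈ LinearMap.range (mfderivC E F ι y))
    (hη0 : ∀ y, ∀ v ∈ tangentRange E F ι y, η (ι y) v = 0)
    {v : TangentSpace 𝓘(ℝ, E) (ι y₀)} (hv : v ∈ tangentRange E F ι y₀) :
    lieDerivC A η (ι y₀) v = 0 := by
  simp only [lieDerivC, LinearMap.add_apply, LinearMap.smul_apply]
  rw [lieDerivReal_eq_zero_of_tangent hι hA.re hη
      (fun y ↦ ((mem_range_mfderivC_iff _).1 (hAt y)).1) hη0 hv,
    lieDerivReal_eq_zero_of_tangent hι hA.im hη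
      (fun y ↦ ((mem_range_mfderivC_iff _).1 (hAt y)).2) hη0 hv, smul_zero, add_zero]

end TangentCalculus

/-! ### The twisted bracket along a coisotropic submanifold -/

namespace ExtendedPoissonStructure

variable {E : Type*} [NormedAddCommGroup E] [NormedSpace ℂ E] [FiniteDimensional ℂ E]
  {X : Type*} [TopologicalSpace X] [ChartedSpace E X] [IsManifold 𝓘(ℂ, E) ω X]
  (P : ExtendedPoissonStructure E X) {α β β' : Π x : X, Astar E x}

lemma bracket_eq (α β : Π x : X, Astar E x) (x : X) :
    P.bracket α β x = bracketAstar α β x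
      + (lieDerivAstar (fun y ↦ sharp y (P.H y) (α y)) β x
        - lieDerivAstar (fun y ↦ sharp y (P.H y) (β y)) α x
        - dFun (fun y ↦ pairing E y (sharp y (P.H y) (α y)) (β y)) x) := rfl

lemma bracketAstar_swap (α β : Π x : X, Astar E x) (x : X) :
    bracketAstar α β x = -bracketAstar β α x := by
  rw [bracketAstar, bracketAstar, ← projAstar_neg, lieBracketC_swap]
  congr 1
  rw [Prod.neg_mk, neg_sub]

lemma bracket_swap (α β : Π x : X, Astar E x) (x : X) :
    P.bracket α β x = -P.bracket β α x := by
  have h : dFun (E := E) (fun y ↦ pairing E y (sharp y (P.H y) (α y)) (β y)) x =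
      -dFun (fun y ↦ pairing E y (sharp y (P.H y) (β y)) (α y)) x := by
    simp only [pairing_sharp_skew _ _ (α _)]
    rw [dFun, dFun, dC_neg, ← projAstar_neg, Prod.neg_mk, neg_zero]
  rw [bracket_eq, bracket_eq, h, bracketAstar_swap]
  abel

/-- The bracket of `A*_H` without the exact terms. -/
lemma bracket_eq_projAstar (hα : IsSectionAstar α) (hβ : IsSectionAstar β) (x : X) :
    P.bracket α β x = projAstar x
      (lieBracketC (fun y ↦ (α y).1.1) (fun y ↦ (β y).1.1) x
          + lieBracketC (fun y ↦ (sharp y (P.H y) (α y)).1.1) (fun y ↦ (β y).1.1) x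
          + lieBracketC (fun y ↦ (α y).1.1) (fun y ↦ (sharp y (P.H y) (β y)).1.1) x,
        lieDerivC (fun y ↦ (α y).1.1) (fun y ↦ (β y).1.2) x
          + lieDerivC (fun y ↦ (sharp y (P.H y) (α y)).1.1) (fun y ↦ (β y).1.2) x
          + lieDerivC (fun y ↦ (α y).1.1) (fun y ↦ (sharp y (P.H y) (β y)).1.2) x
          - (lieDerivC (fun y ↦ (β y).1.1) (fun y ↦ (α y).1.2) x
            - dC (fun y ↦ evalC E y (α y).1.2 (β y).1.1) x)
          - (lieDerivC (fun y ↦ (β y).1.1) (fun y ↦ (sharp y (P.H y) (α y)).1.2) x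
            - dC (fun y ↦ evalC E y (sharp y (P.H y) (α y)).1.2 (β y).1.1) x)
          - (lieDerivC (fun y ↦ (sharp y (P.H y) (β y)).1.1) (fun y ↦ (α y).1.2) x
            - dC (fun y ↦ evalC E y (α y).1.2 (sharp y (P.H y) (β y)).1.1) x)) := by
  -- A `(1,0)` covector vanishes on a `(0,1)` vector, so this exact term may be inserted freely to
  -- complete a contraction.
  have h0 : dC (E := E) (fun y ↦ evalC E y (α y).1.2 (β y).1.1) x = 0 := by
    have : (fun y ↦ evalC E y (α y).1.2 (β y).1.1) = fun _ ↦ 0 :=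
      funext fun y ↦ (α y).2.2 _ (β y).2.1
    rw [this, dC, mvfderiv_const]
    rfl
  have hb := isSectionA_iff.1 (P.smooth β hβ)
  have ha := isSectionAstar_iff.1 hα
  -- By skewness `-d⟨H♯α, β⟩ = d⟨H♯β, α⟩`, a sum of two exact terms: one cancels the exact term in
  -- `-L_{H♯β} α`, the other completes the contraction of `d` of the form part of `α` with the
  -- vector part of `H♯β`.
  have h1 : dC (E := E) (fun y ↦ pairing E y (sharp y (P.H y) (α y)) (β y)) x =
      -(dC (fun y ↦ evalC E y (α y).1.2 (sharp y (P.H y) (β y)).1.1) x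
        + dC (fun y ↦ evalC E y (sharp y (P.H y) (β y)).1.2 (α y).1.1) x) := by
    simp only [pairing_sharp_skew _ _ (α _)]
    rw [dC_neg, ← dC_add (((ha.2 x).evalC (hb.1 x)).mdifferentiableAt (by simp))
      (((hb.2 x).evalC (ha.1 x)).mdifferentiableAt (by simp))]
    rfl
  rw [bracket_eq, bracketAstar, lieDerivAstar, lieDerivAstar, dFun, ← projAstar_sub,
    ← projAstar_sub, ← projAstar_add]
  congr 1
  rw [h0, h1, lieBracketC_swap (fun y ↦ (α y).1.1) (fun y ↦ (sharp y (P.H y) (β y)).1.1)]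
  ext1
  · simp only [Prod.fst_add, Prod.fst_sub]
    abel
  · simp only [Prod.snd_add, Prod.snd_sub]
    abel

variable {F : Type*} [NormedAddCommGroup F] [NormedSpace ℂ F]
  [FiniteDimensional ℂ F] {Y : Type*} [TopologicalSpace Y] [ChartedSpace F Y]
  [IsManifold 𝓘(ℂ, F) ω Y] {ι : Y → X} {y : Y}

lemma sharp_mem_tangentAnnihilator (hι : MDifferentiableAt 𝓘(ℂ, F) 𝓘(ℂ, E) ι y)
    (hY : IsCoisotropic F P ι) {u : Astar E (ι y)} (hu : u ∈ K E F ι y) :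
    (sharp (ι y) (P.H (ι y)) u).1 ∈ tangentAnnihilator E F ι y :=
  mem_tangentAnnihilator_of_pairing hι fun β hβ ↦ hY y u hu β hβ

/-- In the form of `bracket_eq_projAstar`, `β` and `H♯β` are differentiated only along the vector
parts of `α` and `H♯α`, which are tangent to `Y` at `ι y`. The three contraction terms need only the
values of `β` and `H♯β` at this point. -/
lemma bracket_congr_right (hι : MDifferentiableAt 𝓘(ℂ, F) 𝓘(ℂ, E) ι y)
    (hY : IsCoisotropic F P ι) (hα : IsSectionAstar α) (hβ : IsSectionAstar β)
    (hβ' : IsSectionAstar β') (hαK : α (ι y) ∈ K E F ι y) (h : ∀ z, β (ι z) = β' (ι z)) :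
    P.bracket α β (ι y) = P.bracket α β' (ι y) := by
  have hιr := (HasMFDerivAt.restrictScalars_real hι.hasMFDerivAt).mdifferentiableAt
  have h1 := ((mem_K_iff hι _).1 hαK).1
  have h2 := (P.sharp_mem_tangentAnnihilator hι hY hαK).1
  have a := isSectionAstar_iff.1 hα
  have b := isSectionAstar_iff.1 hβ
  have b' := isSectionAstar_iff.1 hβ'
  have sa := isSectionA_iff.1 (P.smooth α hα)
  have sb := isSectionA_iff.1 (P.smooth β hβ)
  have sb' := isSectionA_iff.1 (P.smooth β' hβ')
  rw [bracket_eq_projAstar P hα hβ, bracket_eq_projAstar P hα hβ',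
    lieBracketC_congr_of_tangent hιr (a.1 _) (b.1 _) (b'.1 _) h1 fun z ↦ by rw [h z],
    lieBracketC_congr_of_tangent hιr (sa.1 _) (b.1 _) (b'.1 _) h2 fun z ↦ by rw [h z],
    lieBracketC_congr_of_tangent hιr (a.1 _) (sb.1 _) (sb'.1 _) h1 fun z ↦ by rw [h z],
    lieDerivC_congr_of_tangent hιr (a.1 _) (b.2 _) (b'.2 _) h1 fun z ↦ by rw [h z],
    lieDerivC_congr_of_tangent hιr (sa.1 _) (b.2 _) (b'.2 _) h2 fun z ↦ by rw [h z],
    lieDerivC_congr_of_tangent hιr (a.1 _) (sb.2 _) (sb'.2 _) h1 fun z ↦ by rw [h z],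
    lieDerivC_sub_dC_congr (b.1 _) (b'.1 _) (a.2 _) (by rw [h y]),
    lieDerivC_sub_dC_congr (b.1 _) (b'.1 _) (sa.2 _) (by rw [h y]),
    lieDerivC_sub_dC_congr (sb.1 _) (sb'.1 _) (a.2 _) (by rw [h y])]

/-- By coisotropy `α`, `β`, `H♯α` and `H♯β` all lie in `T_ℂ Y ⊕ Ann(T_ℂ Y)` along `Y`, so every term
of `bracket_eq_projAstar` stays in this bundle, and the projection to `A*` lands in `K`. -/
lemma bracket_mem_K (hι : Manifold.IsSmoothEmbedding 𝓘(ℂ, F) 𝓘(ℂ, E) ω ι)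
    (hY : IsCoisotropic F P ι) (hα : IsSectionAstar α) (hβ : IsSectionAstar β)
    (hαK : ∀ z, α (ι z) ∈ K E F ι z) (hβK : ∀ z, β (ι z) ∈ K E F ι z) (y : Y) :
    P.bracket α β (ι y) ∈ K E F ι y := by
  have hd (z : Y) : MDifferentiableAt 𝓘(ℂ, F) 𝓘(ℂ, E) ι z :=
    (hι.contMDiff z).mdifferentiableAt (by simp)
  have hιr := (HasMFDerivAt.restrictScalars_real (hd y).hasMFDerivAt).mdifferentiableAt
  have ta (z : Y) := (mem_K_iff (hd z) _).1 (hαK z)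
  have tb (z : Y) := (mem_K_iff (hd z) _).1 (hβK z)
  have tsa (z : Y) := P.sharp_mem_tangentAnnihilator (hd z) hY (hαK z)
  have tsb (z : Y) := P.sharp_mem_tangentAnnihilator (hd z) hY (hβK z)
  have a := isSectionAstar_iff.1 hα
  have b := isSectionAstar_iff.1 hβ
  have sa := isSectionA_iff.1 (P.smooth α hα)
  have sb := isSectionA_iff.1 (P.smooth β hβ)
  have exact_zero {A : Π x : X, TC E x} {η : Π x : X, CotC E x} (hA : SmoothTCAt A (ι y))
      (hη : SmoothFormAt η (ι y)) (hAη : ∀ z, evalC E (ι z) (η (ι z)) (A (ι z)) = 0)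
      {v : TangentSpace 𝓘(ℝ, E) (ι y)} (hv : v ∈ tangentRange E F ι y) :
      dC (fun x ↦ evalC E x (η x) (A x)) (ι y) v = 0 :=
    mvfderiv_eq_zero_of_comp hιr ((hη.evalC hA).mdifferentiableAt (by simp))
      (Filter.Eventually.of_forall hAη) hv
  rw [bracket_eq_projAstar P hα hβ]
  refine projAstar_mem_K (hd y) ⟨?_, fun v hv ↦ ?_⟩
  · exact add_mem (add_mem
      (lieBracketC_mem_range hι (a.1 _) (b.1 _) (fun z ↦ (ta z).1) fun z ↦ (tb z).1)
      (lieBracketC_mem_range hι (sa.1 _) (b.1 _) (fun z ↦ (tsa z).1) fun z ↦ (tb z).1))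
      (lieBracketC_mem_range hι (a.1 _) (sb.1 _) (fun z ↦ (ta z).1) fun z ↦ (tsb z).1)
  · simp only [LinearMap.add_apply, LinearMap.sub_apply]
    rw [lieDerivC_eq_zero_of_tangent hι (a.1 _) (b.2 _) (fun z ↦ (ta z).1) (fun z ↦ (tb z).2) hv,
      lieDerivC_eq_zero_of_tangent hι (sa.1 _) (b.2 _) (fun z ↦ (tsa z).1)
        (fun z ↦ (tb z).2) hv,
      lieDerivC_eq_zero_of_tangent hι (a.1 _) (sb.2 _) (fun z ↦ (ta z).1)
        (fun z ↦ (tsb z).2) hv,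
      lieDerivC_eq_zero_of_tangent hι (b.1 _) (a.2 _) (fun z ↦ (tb z).1) (fun z ↦ (ta z).2) hv,
      lieDerivC_eq_zero_of_tangent hι (b.1 _) (sa.2 _) (fun z ↦ (tb z).1)
        (fun z ↦ (tsa z).2) hv,
      lieDerivC_eq_zero_of_tangent hι (sb.1 _) (a.2 _) (fun z ↦ (tsb z).1)
        (fun z ↦ (ta z).2) hv,
      exact_zero (b.1 _) (a.2 _) (fun z ↦ evalC_eq_zero_of_mem (ta z) (tb z)) hv,
      exact_zero (b.1 _) (sa.2 _) (fun z ↦ evalC_eq_zero_of_mem (tsa z) (tb z)) hv,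
      exact_zero (sb.1 _) (a.2 _) (fun z ↦ evalC_eq_zero_of_mem (ta z) (tsb z)) hv]
    simp

end ExtendedPoissonStructure

/-- The restriction of a smooth section to a submanifold is smooth. -/
lemma IsSectionAstar.smoothAlong {E : Type*} [NormedAddCommGroup E] [NormedSpace ℂ E]
    [FiniteDimensional ℂ E] {X : Type*} [TopologicalSpace X] [ChartedSpace E X]
    [IsManifold 𝓘(ℂ, E) ω X] {F : Type*} [NormedAddCommGroup F] [NormedSpace ℂ F]
    {Y : Type*} [TopologicalSpace Y] [ChartedSpace F Y] {ι : Y → X} {α : Π x : X, Astar E x}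
    (hα : IsSectionAstar α) (hι : ContMDiff 𝓘(ℝ, F) 𝓘(ℝ, E) ∞ ι) :
    SmoothAlong F ι (fun y ↦ (α (ι y)).1) :=
  ⟨hα.re.comp hι, hα.im.comp hι, hα.form.comp hι⟩

end ExtendedPoisson

end

theorem mainTheorem5
    {E : Type*} [NormedAddCommGroup E] [NormedSpace ℂ E] [FiniteDimensional ℂ E]
    {X : Type*} [TopologicalSpace X] [T2Space X] [ChartedSpace E X] [IsManifold 𝓘(ℂ, E) ω X]
    {F : Type*} [NormedAddCommGroup F] [NormedSpace ℂ F] [FiniteDimensional ℂ F]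
    {Y : Type*} [TopologicalSpace Y] [ChartedSpace F Y] [IsManifold 𝓘(ℂ, F) ω Y]
    (P : ExtendedPoisson.ExtendedPoissonStructure E X)
    (ι : Y → X) (hι : Manifold.IsSmoothEmbedding 𝓘(ℂ, F) 𝓘(ℂ, E) ω ι)
    (hY : ExtendedPoisson.IsCoisotropic F P ι) :
    (∀ y : Y, ∀ u ∈ ExtendedPoisson.K E F ι y,
      P.anchor (ι y) u ∈ LinearMap.range (ExtendedPoisson.mfderivC E F ι y)) ∧
    (∀ u v : Π y : Y, ExtendedPoisson.Astar E (ι y),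
      ExtendedPoisson.IsSectionK E F ι u → ExtendedPoisson.IsSectionK E F ι v →
      ∃ w : Π y : Y, ExtendedPoisson.Astar E (ι y), ExtendedPoisson.IsSectionK E F ι w ∧
        ∀ u' v' : Π x : X, ExtendedPoisson.Astar E x,
          ExtendedPoisson.IsSectionAstar u' → ExtendedPoisson.IsSectionAstar v' →
          (∀ y : Y, u' (ι y) = u y) → (∀ y : Y, v' (ι y) = v y) →
          ∀ y : Y, P.bracket u' v' (ι y) = w y) := by
  have hd (y : Y) : MDifferentiableAt 𝓘(ℂ, F) 𝓘(ℂ, E) ι y :=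
    (hι.contMDiff y).mdifferentiableAt (by simp)
  refine ⟨fun y u hu ↦ ?_, fun u v hu hv ↦ ?_⟩
  · exact add_mem ((ExtendedPoisson.mem_K_iff (hd y) u).1 hu).1
      (P.sharp_mem_tangentAnnihilator (hd y) hY hu).1
  -- `w` must be chosen before the extensions. If a pair of global extensions exists, one fixed pair
  -- defines `w`.
  · by_cases h : ∃ α β : Π x : X, ExtendedPoisson.Astar E x,
        ExtendedPoisson.IsSectionAstar α ∧ ExtendedPoisson.IsSectionAstar β ∧
          (∀ y : Y, α (ι y) = u y) ∧ ∀ y : Y, β (ι y) = v y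
    · obtain ⟨α, β, hα, hβ, hαu, hβv⟩ := h
      have hαK (y : Y) : α (ι y) ∈ ExtendedPoisson.K E F ι y := hαu y ▸ hu.2 y
      have hβK (y : Y) : β (ι y) ∈ ExtendedPoisson.K E F ι y := hβv y ▸ hv.2 y
      refine ⟨fun y ↦ P.bracket α β (ι y), ⟨?_, P.bracket_mem_K hι hY hα hβ hαK hβK⟩, ?_⟩
      · exact (P.isSectionAstar_bracket hα hβ).smoothAlong fun y ↦
          (ExtendedPoisson.ContMDiffAt.restrictScalars_real (hι.contMDiff y)).of_le le_top
      · intro u' v' hu' hv' hu'u hv'v y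
        -- The second argument is replaced first; the swap makes the first argument accessible to
        -- the same lemma.
        rw [P.bracket_congr_right (hd y) hY hu' hv' hβ (by rw [hu'u y]; exact hu.2 y)
            fun z ↦ (hv'v z).trans (hβv z).symm,
          P.bracket_swap, P.bracket_congr_right (hd y) hY hβ hu' hα (hβK y)
            fun z ↦ (hu'u z).trans (hαu z).symm, ← P.bracket_swap]
    -- Without global extensions the condition on `w` is empty and any smooth section of `K` serves,
    -- for instance `u`.
    · exact ⟨u, hu, fun u' v' hu' hv' hu'u hv'v ↦ (h ⟨u', v', hu', hv', hu'u, hv'v⟩).elim⟩
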